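/- Let $\Sigma$ be a finite alphabet. Let $\#\mathsf{L}$ be the class of functions $\varphi\colon \Sigma^*\to\mathbb{N}$ for which there is a nondeterministic Turing machine $M$, with a two-way read-only input tape and finitely many work tapes, which on inputs of length $n$ uses work space $O(\log n)$ and halts on every computation branch, and such that for every $x\in\Sigma^*$ the number of accepting computation branches of $M$ on input $x$ is $\varphi(x)$. For an integer $k\ge 2$, let $\mathsf{coMod}_k\mathsf{L}$ be the class of languages $L\subseteq\Sigma^*$ for which there is $\varphi\in\#\mathsf{L}$ such that for all $x\in\Sigma^*$: $x\in L$ if and only if $\varphi(x)\equiv 0\pmod k$. Proposition. For every integer $k\ge 2$ and every language $L\subseteq\Sigma^*$: $L\in\mathsf{coMod}_k\mathsf{L}$ if and only if there exists $\varphi\in\#\mathsf{L}$ such that for all $x\in\Sigma^*$: $x\in L$ if and only if $\gcd(\varphi(x),k)=1$. -/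

import Mathlib

/-- A head movement. -/
inductive HeadMove where
  | left
  | stay
  | right

/-- What the head of the input tape can see: an end marker or a letter of the input. -/
inductive InputSymbol (α : Type) where
  | leftEnd
  | letter (a : α)
  | rightEnd

/-- One instruction: the next state, the movement of the input head and, for each work tape,
the symbol to be written and the movement of its head. -/
structure NTMAction (State Γ Tape : Type) where
  next : State
  moveInput : HeadMove
  write : Tape → Γ
  moveWork : Tape → HeadMove

/-- A nondeterministic Turing machine with a two-way read-only input tape over the alphabet `α`
and finitely many two-way infinite read/write work tapes. `trans q s g` is the set of instructions
that may be executed in state `q` when the input head scans `s` and the head of work tape `i`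
scans `g i`. The machine halts when this set is empty. -/
structure NTM (α : Type) where
  State : Type
  Γ : Type
  Tape : Type
  [finiteState : Finite State]
  [finiteΓ : Finite Γ]
  [finiteTape : Finite Tape]
  blank : Γ
  start : State
  accept : Set State
  trans : State → InputSymbol α → (Tape → Γ) → Set (NTMAction State Γ Tape)

namespace NTM

variable {α : Type}

/-- The cells of the input tape are numbered `0, …, n + 1`, where `n` is the length of the input:
cell `0` holds the left end marker, cells `1, …, n` the input, cell `n + 1` the right end marker. -/
def inputSymbol (x : List α) : ℕ → InputSymbol α
  | 0 => .leftEnd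
  | i + 1 => (x[i]?).elim .rightEnd .letter

/-- The input head cannot leave the cells `0, …, n + 1`. -/
def moveInputHead (x : List α) (i : ℕ) : HeadMove → ℕ
  | .left => i - 1
  | .stay => i
  | .right => min (i + 1) (x.length + 1)

def moveWorkHead (i : ℤ) : HeadMove → ℤ
  | .left => i - 1
  | .stay => i
  | .right => i + 1

/-- A configuration of `M` (on a fixed input). -/
structure Cfg (M : NTM α) where
  state : M.State
  inputHead : ℕ
  workHead : M.Tape → ℤ
  cells : M.Tape → ℤ → M.Γ

/-- Initially all work tapes are blank, and the input head is on the left end marker. -/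
def init (M : NTM α) : M.Cfg where
  state := M.start
  inputHead := 0
  workHead := fun _ => 0
  cells := fun _ _ => M.blank

/-- The instructions that may be executed in configuration `c` on input `x`. -/
def enabled (M : NTM α) (x : List α) (c : M.Cfg) : Set (NTMAction M.State M.Γ M.Tape) :=
  M.trans c.state (inputSymbol x c.inputHead) (fun i => c.cells i (c.workHead i))

/-- The configuration that results from executing the instruction `a`. -/
def exec (M : NTM α) (x : List α) (c : M.Cfg) (a : NTMAction M.State M.Γ M.Tape) : M.Cfg where
  state := a.next
  inputHead := moveInputHead x c.inputHead a.moveInput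
  workHead := fun i => moveWorkHead (c.workHead i) (a.moveWork i)
  cells := fun i => Function.update (c.cells i) (c.workHead i) (a.write i)

/-- `c'` is a successor of `c` on input `x`. -/
def Step (M : NTM α) (x : List α) (c c' : M.Cfg) : Prop :=
  ∃ a ∈ M.enabled x c, c' = M.exec x c a

/-- `c` occurs in some computation on input `x`. -/
def Reachable (M : NTM α) (x : List α) (c : M.Cfg) : Prop :=
  Relation.ReflTransGen (M.Step x) M.init c

/-- `M` has no infinite computation on any input: the converse of the step relation is
well-founded below the initial configuration. -/
def HaltsOnAllBranches (M : NTM α) : Prop :=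
  ∀ x : List α, Acc (fun c' c => M.Step x c c') M.init

/-- `M` works in space `O(log n)`: on inputs of length `n`, in every branch, each work head stays
within distance `O(log n)` of its initial cell. -/
def IsLogspace (M : NTM α) : Prop :=
  ∃ C : ℕ, ∀ (x : List α) (c : M.Cfg), M.Reachable x c →
    ∀ i : M.Tape, |c.workHead i| ≤ (C * (Nat.log 2 x.length + 1) : ℕ)

/-- The list of instructions `b` is a complete accepting computation branch from `c`
on input `x`: it can be executed from `c` and ends in a halting configuration whose state is
accepting. -/
def IsAcceptingBranch (M : NTM α) (x : List α) :
    M.Cfg → List (NTMAction M.State M.Γ M.Tape) → Prop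
  | c, [] => M.enabled x c = ∅ ∧ c.state ∈ M.accept
  | c, a :: b => a ∈ M.enabled x c ∧ IsAcceptingBranch M x (M.exec x c a) b

/-- The number of accepting branches of `M` on input `x` (they are finitely many if `M` halts on
all branches). -/
noncomputable def numAccepting (M : NTM α) (x : List α) : ℕ :=
  {b | M.IsAcceptingBranch x M.init b}.ncard

end NTM

/-- The class `#L` of functions that count the accepting branches of a nondeterministic logspace
Turing machine (which halts on all branches). -/
def SharpL (α : Type) : Set (List α → ℕ) :=
  {φ | ∃ M : NTM α, M.IsLogspace ∧ M.HaltsOnAllBranches ∧ ∀ x, φ x = M.numAccepting x}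

/-- The class `coMod_k L`. -/
def CoModL (k : ℕ) (α : Type) : Set (Language α) :=
  {L | ∃ φ ∈ SharpL α, ∀ x, x ∈ L ↔ φ x ≡ 0 [MOD k]}

/-! The theorem reduces to a closure property: if `φ` is in `#L` and `F : ℕ → ℕ` is a combination of
the functions `n ↦ n.choose j` with natural coefficients, then `F ∘ φ` is in `#L`
(`comp_mem_sharpL`). It then remains to find two such `F`.

From divisibility to coprimality: for a prime power `q = p ^ e`, Lucas's theorem shows that `p`
divides `(n + (q - 1)).choose (q - 1)` exactly if `q ∤ n`. Weighting this binomial by `k / q` for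
each prime power `q` exactly dividing `k`, and summing, leaves modulo each prime of `k` only its own
term. The sum is therefore coprime to `k` exactly if `k ∣ n`. From coprimality to divisibility: by
Euler's theorem `n ^ k.totient + (k - 1)` is divisible by `k` exactly if `n` is coprime to `k`. Both
functions lie in `chooseSpan`.

For the closure property, `(φ x).choose j` counts the `j`-element sets of accepting branches, hence
the strictly increasing `j`-tuples of branches in the lexicographic order. A logspace machine can
run `J` copies of `M` in lockstep and guess one instruction per copy and round. It cannot store
branches, but to enforce the order it suffices to remember which pairs of copies have made the same
choices so far. Coefficients come from a parameter guessed at the start. There is only one input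
head, so each copy keeps its input position in a binary counter, which is counted down to place the
head and counted up again to bring it back. -/

instance : Finite HeadMove :=
  Finite.of_injective (fun m : HeadMove => (match m with | .left => 0 | .stay => 1 | .right => 2 : Fin 3))
    (by intro a b; cases a <;> cases b <;> simp)

instance {State Γ Tape : Type} [Finite State] [Finite Γ] [Finite Tape] :
    Finite (NTMAction State Γ Tape) :=
  Finite.of_injective (fun a => (a.next, a.moveInput, a.write, a.moveWork))
    (by rintro ⟨⟩ ⟨⟩; simp)

attribute [instance] NTM.finiteState NTM.finiteΓ NTM.finiteTape

/-! ### Certificates for halting, space and number of accepting branches; bounds on computation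
length -/

namespace NTM

variable {α : Type}

/-- The instructions of `M`. -/
abbrev Action (M : NTM α) : Type := NTMAction M.State M.Γ M.Tape

/-- `M.Run x B c n`: on input `x`, every computation from `c` halts and keeps the work heads within
distance `B` of the origin, accepting configurations met on the way are halting, and exactly `n`
branches from `c` accept. -/
inductive Run (M : NTM α) (x : List α) (B : ℕ) : M.Cfg → ℕ → Prop
  | accept (c : M.Cfg) (hB : ∀ t, |c.workHead t| ≤ B) (h : M.enabled x c = ∅)
      (ha : c.state ∈ M.accept) : Run M x B c 1
  | step (c : M.Cfg) (hB : ∀ t, |c.workHead t| ≤ B) (ha : c.state ∉ M.accept)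
      (s : Finset M.Action) (h : M.enabled x c = s) (n : M.Action → ℕ)
      (hn : ∀ a ∈ s, Run M x B (M.exec x c a) (n a)) : Run M x B c (∑ a ∈ s, n a)

namespace Run

variable {M : NTM α} {x : List α} {B : ℕ} {c : M.Cfg} {n : ℕ}

theorem acc (h : M.Run x B c n) : Acc (fun c' c => M.Step x c c') c := by
  induction h with
  | accept c hB h ha =>
    refine ⟨_, ?_⟩
    rintro _ ⟨a, h', rfl⟩
    simp [h] at h'
  | step c hB ha s h n hn ih =>
    refine ⟨_, ?_⟩
    rintro _ ⟨a, h', rfl⟩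
    exact ih a (by simpa [h] using h')

theorem workHead_le (h : M.Run x B c n) {c' : M.Cfg}
    (hr : Relation.ReflTransGen (M.Step x) c c') (t : M.Tape) : |c'.workHead t| ≤ B := by
  induction h generalizing c' with
  | accept c hB h ha =>
    rcases hr.cases_head with rfl | ⟨_, ⟨a, h', rfl⟩, _⟩
    · exact hB t
    · simp [h] at h'
  | step c hB ha s h n hn ih =>
    rcases hr.cases_head with rfl | ⟨_, ⟨a, h', rfl⟩, h2⟩
    · exact hB t
    · exact ih a (by simpa [h] using h') h2

/-- A nonempty branch is a first instruction together with a branch from the resulting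
configuration, so counts add over the instructions. The empty branch contributes only at halting
accepting configurations, which is why `Run.step` demands a non-accepting state. -/
theorem exists_finset (h : M.Run x B c n) :
    ∃ F : Finset (List M.Action), F.card = n ∧ ∀ b, b ∈ F ↔ M.IsAcceptingBranch x c b := by
  classical
  induction h with
  | accept c hB h ha =>
    refine ⟨{[]}, rfl, ?_⟩
    rintro (_ | ⟨a, b⟩) <;> simp [IsAcceptingBranch, h, ha]
  | step c hB ha s h n hn ih =>
    choose! F hF hF' using ih
    refine ⟨(s.sigma F).map ⟨fun p => p.1 :: p.2, ?_⟩, ?_, ?_⟩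
    · rintro ⟨a, b⟩ ⟨a', b'⟩; simp +contextual
    · rw [Finset.card_map, Finset.card_sigma]
      exact Finset.sum_congr rfl hF
    · rintro (_ | ⟨a, b⟩)
      · simp [IsAcceptingBranch, ha]
      · simp only [Finset.mem_map, Finset.mem_sigma, IsAcceptingBranch, h, Finset.mem_coe]
        constructor
        · rintro ⟨⟨a, b⟩, ⟨h1, h2⟩, h3⟩
          obtain ⟨rfl, rfl⟩ := List.cons.inj h3
          exact ⟨h1, (hF' a h1 b).1 h2⟩
        · rintro ⟨h1, h2⟩
          exact ⟨⟨a, b⟩, ⟨h1, (hF' a h1 b).2 h2⟩, rfl⟩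

theorem numAccepting_eq (h : M.Run x B M.init n) : M.numAccepting x = n := by
  obtain ⟨F, hF, hF'⟩ := h.exists_finset
  rw [numAccepting, ← hF, ← Set.ncard_coe_finset]
  congr 1
  ext b
  simp [hF']

/-- A deterministic step. -/
theorem det (a : M.Action) (hB : ∀ t, |c.workHead t| ≤ B) (ha : c.state ∉ M.accept)
    (h : M.enabled x c = {a}) (hn : M.Run x B (M.exec x c a) n) : M.Run x B c n := by
  simpa using Run.step c hB ha {a} (by simpa using h) (fun _ => n) (by simpa using hn)

theorem reject (hB : ∀ t, |c.workHead t| ≤ B) (ha : c.state ∉ M.accept)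
    (h : M.enabled x c = ∅) : M.Run x B c 0 := by
  simpa using Run.step c hB ha ∅ (by simpa using h) (fun _ => 0) (by simp)

/-- A nondeterministic step whose instructions are given by an injective family. -/
theorem branch {ι : Type} (s : Finset ι) (f : ι → M.Action) (hf : Function.Injective f)
    (m : ι → ℕ) (hB : ∀ t, |c.workHead t| ≤ B) (ha : c.state ∉ M.accept)
    (h : ∀ a, a ∈ M.enabled x c ↔ ∃ i ∈ s, f i = a)
    (hn : ∀ i ∈ s, M.Run x B (M.exec x c (f i)) (m i)) : M.Run x B c (∑ i ∈ s, m i) := by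
  -- `Run.step` wants a count for every instruction; the value 0 outside the range of `f` never
  -- enters the sum.
  have := Run.step (x := x) (B := B) c hB ha (s.map ⟨f, hf⟩) (by ext a; simp [h]) (Function.extend f m 0) (by
    intro a ha
    obtain ⟨i, hi, rfl⟩ := Finset.mem_map.1 ha
    simpa [hf.extend_apply] using hn i hi)
  simpa [hf.extend_apply] using this

end Run

theorem mem_sharpL_of_run {φ : List α → ℕ} (M : NTM α) (C : ℕ)
    (h : ∀ x, M.Run x (C * (Nat.log 2 x.length + 1)) M.init (φ x)) : φ ∈ SharpL α :=
  ⟨M, ⟨C, fun x _ hc t => (h x).workHead_le hc t⟩, fun x => (h x).acc,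
    fun x => (h x).numAccepting_eq.symm⟩

/-- All computations from `c` on input `x` have at most `t` steps. -/
def HaltsWithin (M : NTM α) (x : List α) : ℕ → M.Cfg → Prop
  | 0, c => M.enabled x c = ∅
  | t + 1, c => ∀ a ∈ M.enabled x c, M.HaltsWithin x t (M.exec x c a)

theorem HaltsWithin.succ {M : NTM α} {x : List α} {t : ℕ} {c : M.Cfg}
    (h : M.HaltsWithin x t c) : M.HaltsWithin x (t + 1) c := by
  induction t generalizing c with
  | zero =>
    intro a ha
    rw [HaltsWithin] at h
    simp [h] at ha
  | succ t ih => exact fun a ha => ih (h a ha)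

theorem HaltsWithin.mono {M : NTM α} {x : List α} {t t' : ℕ} {c : M.Cfg} (htt : t ≤ t')
    (h : M.HaltsWithin x t c) : M.HaltsWithin x t' c := by
  induction htt with
  | refl => exact h
  | step _ ih => exact ih.succ

/-- There are only finitely many instructions, so the bounds for the successors have a common upper
bound, and well-foundedness turns into a uniform bound on the length of branches. -/
theorem exists_haltsWithin {M : NTM α} {x : List α} {c : M.Cfg}
    (h : Acc (fun c' c => M.Step x c c') c) : ∃ t, M.HaltsWithin x t c := by
  induction h with
  | intro c _ ih =>
    have : ∀ a : M.Action, ∃ t, a ∈ M.enabled x c → M.HaltsWithin x t (M.exec x c a) := by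
      intro a
      by_cases ha : a ∈ M.enabled x c
      · obtain ⟨t, ht⟩ := ih _ ⟨a, ha, rfl⟩
        exact ⟨t, fun _ => ht⟩
      · exact ⟨0, fun h => absurd h ha⟩
    choose t ht using this
    obtain ⟨T, hT⟩ := (Set.finite_range t).bddAbove
    exact ⟨T + 1, fun a ha => (ht a ha).mono (hT ⟨a, rfl⟩)⟩

theorem IsAcceptingBranch.length_le {M : NTM α} {x : List α} {t : ℕ} {c : M.Cfg}
    {b : List M.Action} (h : M.HaltsWithin x t c) (hb : M.IsAcceptingBranch x c b) :
    b.length ≤ t := by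
  induction t generalizing c b with
  | zero =>
    cases b with
    | nil => simp
    | cons a b =>
      rw [HaltsWithin] at h
      simp [IsAcceptingBranch, h] at hb
  | succ t ih =>
    cases b with
    | nil => simp
    | cons a b => simpa using ih (h a hb.1) hb.2

theorem finite_isAcceptingBranch {M : NTM α} {x : List α} {t : ℕ} {c : M.Cfg}
    (h : M.HaltsWithin x t c) : {b | M.IsAcceptingBranch x c b}.Finite :=
  (List.finite_length_le M.Action t).subset fun _ hb => hb.length_le h

theorem Reachable.inputHead_le {M : NTM α} {x : List α} {c : M.Cfg} (h : M.Reachable x c) :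
    c.inputHead ≤ x.length + 1 := by
  induction h with
  | refl => simp [init]
  | tail _ h ih =>
    obtain ⟨a, -, rfl⟩ := h
    simp only [exec]
    cases a.moveInput <;> simp only [moveInputHead] <;> omega

theorem Reachable.exec {M : NTM α} {x : List α} {c : M.Cfg} (h : M.Reachable x c)
    {a : M.Action} (ha : a ∈ M.enabled x c) : M.Reachable x (M.exec x c a) :=
  h.tail ⟨a, ha, rfl⟩

end NTM

/-! ### Binary counters on a tape -/

namespace NTM

variable {α : Type}

theorem Cfg.eq_of {M : NTM α} {c c' : M.Cfg} (h₁ : c.state = c'.state)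
    (h₂ : c.inputHead = c'.inputHead) (h₃ : ∀ t, c.workHead t = c'.workHead t)
    (h₄ : ∀ t, c.cells t = c'.cells t) : c = c' := by
  cases c; cases c'
  simp only [Cfg.mk.injEq]
  exact ⟨h₁, h₂, funext h₃, funext h₄⟩

/-- The content of a tape that holds `l` in the cells `0, 1, …` and is blank elsewhere. -/
def listTape (l : List Bool) : ℤ → Option Bool
  | .ofNat n => l[n]?
  | .negSucc _ => none

theorem listTape_natCast (l : List Bool) (n : ℕ) : listTape l n = l[n]? := rfl

theorem listTape_append_length (l r : List Bool) : listTape (l ++ r) l.length = r.head? := by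
  rw [listTape_natCast, List.getElem?_append_right le_rfl, Nat.sub_self, List.head?_eq_getElem?]

theorem update_listTape (l r : List Bool) (v : Bool) :
    Function.update (listTape (l ++ r)) l.length (some v) = listTape (l ++ v :: r.tail) := by
  funext z
  rcases z with m | m
  · change Function.update (listTape (l ++ r)) _ _ (m : ℤ) = listTape _ (m : ℤ)
    rcases lt_trichotomy m l.length with h | rfl | h
    · rw [Function.update_of_ne (by exact_mod_cast h.ne), listTape_natCast, listTape_natCast,
        List.getElem?_append_left h, List.getElem?_append_left h]
    · rw [Function.update_self, listTape_append_length, List.head?_cons]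
    · rw [Function.update_of_ne (by exact_mod_cast h.ne'), listTape_natCast, listTape_natCast,
        List.getElem?_append_right h.le, List.getElem?_append_right h.le]
      obtain ⟨d, hd⟩ : ∃ d, m - l.length = d + 1 := ⟨m - l.length - 1, by omega⟩
      rw [hd, List.getElem?_cons_succ]
      cases r <;> simp
  · rw [Function.update_of_ne (by simp [Int.negSucc_eq]; omega)]
    rfl

/-- The number with the binary digits `l`, least significant digit first. -/
def bitsVal : List Bool → ℕ
  | [] => 0
  | b :: l => b.toNat + 2 * bitsVal l

theorem bitsVal_replicate_true_append (p : ℕ) (l : List Bool) :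
    bitsVal (List.replicate p true ++ l) + 1 = 2 ^ p * (bitsVal l + 1) := by
  induction p with
  | zero => simp
  | succ p ih =>
    simp only [List.replicate_succ, List.cons_append, bitsVal, Bool.toNat_true, pow_succ]
    linarith

theorem bitsVal_replicate_false_append (p : ℕ) (l : List Bool) :
    bitsVal (List.replicate p false ++ l) = 2 ^ p * bitsVal l := by
  induction p with
  | zero => simp
  | succ p ih =>
    simp only [List.replicate_succ, List.cons_append, bitsVal, Bool.toNat_false, pow_succ, ih]
    ring

/-- The prefix of equal digits is the range of a carry (`b = true`) or of a borrow (`b = false`). -/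
theorem exists_eq_replicate_append (b : Bool) (l : List Bool) :
    ∃ p, l = List.replicate p b ∨ ∃ r, l = List.replicate p b ++ (!b) :: r := by
  induction l with
  | nil => exact ⟨0, .inl rfl⟩
  | cons v l ih =>
    by_cases hv : v = b
    · subst hv
      obtain ⟨p, rfl | ⟨r, rfl⟩⟩ := ih
      · exact ⟨p + 1, .inl rfl⟩
      · exact ⟨p + 1, .inr ⟨r, rfl⟩⟩
    · refine ⟨0, .inr ⟨l, ?_⟩⟩
      cases v <;> cases b <;> simp_all

/-! ### The machine simulating several copies of `M` -/

namespace Copies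

/-- What the machine simulating `J` copies of `M` remembers during a round: the parameter chosen
at the beginning, the states of the copies, which pairs of copies have been following the same
branch, and the guessed instruction for every copy (`none` if the copy has halted). -/
structure Context (M : NTM α) (J : ℕ) (ι : Type) where
  idx : ι
  st : Fin J → M.State
  tie : Fin J → Fin J → Prop
  guess : Fin J → Option M.Action

/-- The control states of the machine simulating `J` copies of `M`. -/
inductive Control (M : NTM α) (J : ℕ) (ι : Type) where
  | start
  | main (k : ι) (st : Fin J → M.State) (tie : Fin J → Fin J → Prop)
  | next (κ : Context M J ι) (i : Fin (J + 1))
  | scan (κ : Context M J ι) (i : Fin J) (b : Bool)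
  | ret (κ : Context M J ι) (i : Fin J) (b f : Bool)
  | act (κ : Context M J ι) (i : Fin J)
  | rewind (κ : Context M J ι) (i : Fin J)

variable (M : NTM α) (J : ℕ) (ι : Type)

instance [Finite ι] : Finite (Context M J ι) :=
  Finite.of_injective (fun κ => (κ.idx, κ.st, κ.tie, κ.guess)) (by rintro ⟨⟩ ⟨⟩; simp)

instance [Finite ι] : Finite (Control M J ι) :=
  Finite.of_injective
    (β := Unit ⊕ (ι × (Fin J → M.State) × (Fin J → Fin J → Prop)) ⊕
      (Context M J ι × Fin (J + 1)) ⊕ (Context M J ι × Fin J × Bool) ⊕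
      (Context M J ι × Fin J × Bool × Bool) ⊕ (Context M J ι × Fin J) ⊕ (Context M J ι × Fin J))
    (fun
      | .start => .inl ()
      | .main k s t => .inr (.inl (k, s, t))
      | .next κ i => .inr (.inr (.inl (κ, i)))
      | .scan κ i b => .inr (.inr (.inr (.inl (κ, i, b))))
      | .ret κ i b f => .inr (.inr (.inr (.inr (.inl (κ, i, b, f)))))
      | .act κ i => .inr (.inr (.inr (.inr (.inr (.inl (κ, i))))))
      | .rewind κ i => .inr (.inr (.inr (.inr (.inr (.inr (κ, i))))))) (by
    intro a b
    cases a <;> cases b <;> simp)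

/-- Copy `i` has its own work tapes and one tape for the position of its input head. -/
abbrev CopyTape : Type := Fin J × Option M.Tape

/-- Tape symbols: a binary digit (or blank), and a symbol of `M`. -/
abbrev Symbol : Type := Option Bool × M.Γ

variable {M J ι}

/-- Change the state, and move the input head. -/
def idle (g : CopyTape M J → Symbol M) (m : HeadMove) (q : Control M J ι) :
    NTMAction (Control M J ι) (Symbol M) (CopyTape M J) :=
  ⟨q, m, g, fun _ => .stay⟩

/-- Write `v` on the counter tape of copy `i` and move its head. -/
def counterAction [DecidableEq M.Tape] (g : CopyTape M J → Symbol M) (i : Fin J) (v : Option Bool)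
    (mw m : HeadMove) (q : Control M J ι) :
    NTMAction (Control M J ι) (Symbol M) (CopyTape M J) :=
  ⟨q, m, Function.update g (i, none) (v, (g (i, none)).2),
    Function.update (fun _ => .stay) (i, none) mw⟩

/-- Execute the instruction `a` of copy `i`. -/
def copyAction (g : CopyTape M J → Symbol M) (i : Fin J) (a : M.Action) (q : Control M J ι) :
    NTMAction (Control M J ι) (Symbol M) (CopyTape M J) where
  next := q
  moveInput := a.moveInput
  write := fun t => match t with
    | (_, none) => g t
    | (k, some t') => if k = i then ((g t).1, a.write t') else g t
  moveWork := fun t => match t with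
    | (_, none) => .stay
    | (k, some t') => if k = i then a.moveWork t' else .stay

/-- The instruction of copy `i` guessed in `κ` is one that copy `i` can execute when scanning
`σ` and `g`. -/
def Context.Valid (active : ι → Fin J → Prop) (κ : Context M J ι) (i : Fin J)
    (E : Set M.Action) : Prop :=
  match κ.guess i with
  | none => active κ.idx i → E = ∅
  | some a => active κ.idx i ∧ a ∈ E

/-- The context after the guessed instruction of copy `i` has been executed. -/
def Context.advance (κ : Context M J ι) (i : Fin J) : Context M J ι :=
  { κ with st := Function.update κ.st i ((κ.guess i).elim (κ.st i) NTMAction.next) }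

/-- The guessed instructions are in non-decreasing order for copies that have been following the
same branch. -/
def Compatible [LT M.Action] (tie : Fin J → Fin J → Prop) (u : Fin J → Option M.Action) : Prop :=
  ∀ i j, tie i j → u i < u j ∨ u i = u j

/-- The pairs of copies that follow the same branch after executing `u`. -/
def nextTie (tie : Fin J → Fin J → Prop) (u : Fin J → Option M.Action) (i j : Fin J) : Prop :=
  tie i j ∧ u i = u j

open Classical in
/-- The transitions of the machine simulating `J` copies of `M`. In every round it guesses an
instruction for every copy, and executes them one after the other. To execute the instruction of
copy `i`, it moves the input head, which is on the left end marker, to the position held by counter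
`i`, which is counted down; after the instruction, the head is moved back, and the counter is
counted up. -/
def trans [LT M.Action] (active : ι → Fin J → Prop) (tie₀ : ι → Fin J → Fin J → Prop) :
    Control M J ι → InputSymbol α → (CopyTape M J → Symbol M) →
      Set (NTMAction (Control M J ι) (Symbol M) (CopyTape M J))
  | .start, _, g => Set.range fun k => idle g .stay (.main k (fun _ => M.start) (tie₀ k))
  | .main k st tie, _, g =>
    {A | ∃ u, Compatible tie u ∧ idle g .stay (.next ⟨k, st, nextTie tie u, u⟩ 0) = A}
  | .next κ i, _, g =>
    if h : (i : ℕ) < J then {idle g .stay (.scan κ ⟨i, h⟩ false)}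
    else if ∃ j, κ.guess j ≠ none then {idle g .stay (.main κ.idx κ.st κ.tie)}
    else ∅
  -- Least significant digit first, incrementing (`b = true`) and decrementing (`b = false`) are the
  -- same operation: pass over the initial digits `b`, write `b` in the next cell, and flip the
  -- passed digits on the way back. A blank met while decrementing means that the counter is zero;
  -- then nothing is flipped (`f = false` in `ret`).
  | .scan κ i b, _, g =>
    if (g (i, none)).1 = some b then {counterAction g i (some b) .right .stay (.scan κ i b)}
    else if (g (i, none)).1 = none ∧ b = false then
      {counterAction g i none .left .stay (.ret κ i b false)}
    else {counterAction g i (some b) .left .stay (.ret κ i b true)}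
  | .ret κ i b f, _, g =>
    match (g (i, none)).1 with
    | some v => {counterAction g i (some (xor v f)) .left .stay (.ret κ i b f)}
    | none =>
      if b then {counterAction g i none .right .stay (.rewind κ i)}
      else if f then {counterAction g i none .right .right (.scan κ i false)}
      else {counterAction g i none .right .stay (.act κ i)}
  | .act κ i, σ, g =>
    if κ.Valid active i (M.trans (κ.st i) σ fun t => (g (i, some t)).2) then
      {(κ.guess i).elim (idle g .stay (.rewind (κ.advance i) i))
        fun a => copyAction g i a (.rewind (κ.advance i) i)}
    else ∅
  | .rewind κ i, σ, g =>
    if σ = .leftEnd then {idle g .stay (.next κ i.succ)}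
    else {idle g .left (.scan κ i true)}

/-- The machine accepts when all active copies have accepted, along different branches. -/
def accept (active : ι → Fin J → Prop) : Set (Control M J ι)
  | .next κ i => (i : ℕ) = J ∧ (∀ j, κ.guess j = none) ∧ (∀ j k, ¬ κ.tie j k) ∧
      ∀ j, active κ.idx j → κ.st j ∈ M.accept
  | _ => False

end Copies

open Copies in
/-- The machine simulating `J` copies of `M`. -/
def copies (M : NTM α) [LT M.Action] (J : ℕ) (ι : Type) [Finite ι]
    (active : ι → Fin J → Prop) (tie₀ : ι → Fin J → Fin J → Prop) : NTM α where
  State := Control M J ι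
  Γ := Symbol M
  Tape := CopyTape M J
  blank := (none, M.blank)
  start := .start
  accept := Copies.accept active
  trans := Copies.trans active tie₀

namespace Copies

variable {M : NTM α} [LT M.Action] {J : ℕ} {ι : Type} [Finite ι]
  {active : ι → Fin J → Prop} {tie₀ : ι → Fin J → Fin J → Prop}

variable (active tie₀) in
/-- The configuration of the machine in which the work tapes of the copies are as in `c`, the
counters hold `l`, and the heads of the counter tapes are at `p`. -/
def enc (q : Control M J ι) (h : ℕ) (c : Fin J → M.Cfg) (l : Fin J → List Bool) (p : Fin J → ℤ) :
    (M.copies J ι active tie₀).Cfg where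
  state := q
  inputHead := h
  workHead := fun (i, t) => t.elim (p i) (c i).workHead
  cells := fun (i, t) z => t.elim (listTape (l i) z, M.blank) fun t => (none, (c i).cells t z)

/-- What the machine scans on its work tapes. -/
def scanned (c : Fin J → M.Cfg) (l : Fin J → List Bool) (p : Fin J → ℤ) : CopyTape M J → Symbol M :=
  fun (i, t) => t.elim (listTape (l i) (p i), M.blank)
    fun t => (none, (c i).cells t ((c i).workHead t))

theorem enabled_enc (x : List α) (q : Control M J ι) (h : ℕ) (c : Fin J → M.Cfg)
    (l : Fin J → List Bool) (p : Fin J → ℤ) :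
    (M.copies J ι active tie₀).enabled x (enc active tie₀ q h c l p) =
      trans active tie₀ q (inputSymbol x h) (scanned c l p) := by
  unfold enabled
  change trans active tie₀ q (inputSymbol x h) _ = _
  congr 1
  funext ⟨i, t⟩
  cases t <;> rfl

theorem exec_idle (x : List α) (q q' : Control M J ι) (h : ℕ) (c : Fin J → M.Cfg)
    (l : Fin J → List Bool) (p : Fin J → ℤ) (m : HeadMove) :
    (M.copies J ι active tie₀).exec x (enc active tie₀ q h c l p) (idle (scanned c l p) m q') =
      enc active tie₀ q' (moveInputHead x h m) c l p := by
  refine Cfg.eq_of rfl rfl (fun _ => rfl) ?_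
  rintro ⟨i, _ | t⟩ <;> exact Function.update_eq_self _ _

theorem exec_counterAction [DecidableEq M.Tape] (x : List α) (q q' : Control M J ι) (h : ℕ)
    (c : Fin J → M.Cfg)
    (l : Fin J → List Bool) (p : Fin J → ℤ) (i : Fin J) (v : Option Bool) (mw m : HeadMove)
    (r : List Bool) (hr : Function.update (listTape (l i)) (p i) v = listTape r) :
    (M.copies J ι active tie₀).exec x (enc active tie₀ q h c l p)
        (counterAction (scanned c l p) i v mw m q') =
      enc active tie₀ q' (moveInputHead x h m) c (Function.update l i r)
        (Function.update p i (moveWorkHead (p i) mw)) := by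
  refine Cfg.eq_of rfl rfl ?_ ?_
  · rintro ⟨k, _ | t⟩
    · change moveWorkHead (p k) (Function.update (fun _ => HeadMove.stay) (i, none) mw (k, none)) =
        Function.update p i (moveWorkHead (p i) mw) k
      by_cases hk : k = i
      · subst hk; simp
      · rw [Function.update_of_ne (by simp [hk]), Function.update_of_ne hk]
        rfl
    · change moveWorkHead _ (Function.update (fun _ => HeadMove.stay) (i, none) mw (k, some t)) = _
      rw [Function.update_of_ne (by simp)]
      rfl
  · rintro ⟨k, _ | t⟩
    · change Function.update (fun z => (listTape (l k) z, M.blank)) (p k)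
        (Function.update (scanned c l p) (i, none) (v, M.blank) (k, none)) =
        fun z => (listTape (Function.update l i r k) z, M.blank)
      by_cases hk : k = i
      · subst hk
        rw [Function.update_self, Function.update_self, ← hr]
        funext z
        by_cases hz : z = p k
        · subst hz; simp
        · simp [hz]
      · rw [Function.update_of_ne (by simp [hk]), Function.update_of_ne hk]
        exact Function.update_eq_self _ _
    · change Function.update (fun z => ((none : Option Bool), (c k).cells t z)) ((c k).workHead t)
        (Function.update (scanned c l p) (i, none) (v, M.blank) (k, some t)) = _
      rw [Function.update_of_ne (by simp)]
      exact Function.update_eq_self _ _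

theorem exec_copyAction (x : List α) (q q' : Control M J ι) (h : ℕ) (c : Fin J → M.Cfg)
    (l : Fin J → List Bool) (p : Fin J → ℤ) (i : Fin J) (a : M.Action) :
    (M.copies J ι active tie₀).exec x (enc active tie₀ q h c l p)
        (copyAction (scanned c l p) i a q') =
      enc active tie₀ q' (moveInputHead x h a.moveInput) (Function.update c i (M.exec x (c i) a))
        l p := by
  refine Cfg.eq_of rfl rfl ?_ ?_
  · rintro ⟨k, _ | t⟩
    · rfl
    · change moveWorkHead ((c k).workHead t) (if k = i then a.moveWork t else .stay) =
        (Function.update c i (M.exec x (c i) a) k).workHead t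
      by_cases hk : k = i
      · subst hk; simp [exec]
      · simp [hk, moveWorkHead]
  · rintro ⟨k, _ | t⟩
    · exact Function.update_eq_self _ _
    · change Function.update (fun z => ((none : Option Bool), (c k).cells t z)) ((c k).workHead t)
        (if k = i then (none, a.write t) else (none, (c k).cells t ((c k).workHead t))) =
        fun z => (none, (Function.update c i (M.exec x (c i) a) k).cells t z)
      by_cases hk : k = i
      · subst hk
        funext z
        by_cases hz : z = (c k).workHead t
        · subst hz; simp [exec]
        · simp [hz, exec]
      · simp only [hk, if_false, ne_eq, not_false_eq_true, Function.update_of_ne]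
        exact Function.update_eq_self _ _

end Copies

end NTM

/-! ### Correctness of the counter operations and of the movement of the input head -/

namespace NTM

variable {α : Type}

namespace Copies

variable {M : NTM α} [LT M.Action] {J : ℕ} {ι : Type} [Finite ι]
  {active : ι → Fin J → Prop} {tie₀ : ι → Fin J → Fin J → Prop} {x : List α} {B : ℕ}

/-- Position `z` for the head of counter `i`, and the origin for the others. -/
def pos (i : Fin J) (z : ℤ) : Fin J → ℤ := Function.update (fun _ => 0) i z

theorem pos_self (i : Fin J) (z : ℤ) : pos i z i = z := by simp [pos]

theorem pos_zero (i : Fin J) : pos i 0 = fun _ => 0 := by simp [pos]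

theorem abs_pos_le {i : Fin J} {z : ℤ} (hz : |z| ≤ B) (k : Fin J) : |pos i z k| ≤ B := by
  by_cases hk : k = i
  · subst hk; simpa [pos_self]
  · simp [pos, hk]

theorem abs_workHead_enc_le {q : Control M J ι} {h : ℕ} {c : Fin J → M.Cfg}
    {l : Fin J → List Bool} {p : Fin J → ℤ} (hc : ∀ k t, |(c k).workHead t| ≤ B)
    (hp : ∀ k, |p k| ≤ B) (t : CopyTape M J) :
    |(enc active tie₀ q h c l p).workHead t| ≤ B := by
  obtain ⟨k, _ | t⟩ := t
  · exact hp k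
  · exact hc k t

theorem run_idle {q q' : Control M J ι} {h n : ℕ} {c : Fin J → M.Cfg}
    {l : Fin J → List Bool} {m : HeadMove}
    (hc : ∀ k t, |(c k).workHead t| ≤ B) (hq : q ∉ accept active)
    (ht : trans active tie₀ q (inputSymbol x h) (scanned c l fun _ => 0) =
      {idle (scanned c l fun _ => 0) m q'})
    (hn : (M.copies J ι active tie₀).Run x B
      (enc active tie₀ q' (moveInputHead x h m) c l fun _ => 0) n) :
    (M.copies J ι active tie₀).Run x B (enc active tie₀ q h c l fun _ => 0) n := by
  refine Run.det (idle (scanned c l fun _ => 0) m q') (abs_workHead_enc_le hc (by simp)) hq ?_ ?_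
  · rw [enabled_enc]; exact ht
  · rw [exec_idle]; exact hn

theorem run_counterAction [DecidableEq M.Tape] {q q' : Control M J ι} {h n : ℕ}
    {c : Fin J → M.Cfg} {l : Fin J → List Bool} {i : Fin J} {v : Option Bool} {mw m : HeadMove}
    {z : ℤ} {r r' : List Bool} (hc : ∀ k t, |(c k).workHead t| ≤ B) (hz : |z| ≤ B)
    (hq : q ∉ accept active)
    (ht : ∀ g : CopyTape M J → Symbol M, (g (i, none)).1 = listTape r z →
      trans active tie₀ q (inputSymbol x h) g = {counterAction g i v mw m q'})
    (hr : Function.update (listTape r) z v = listTape r')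
    (hn : (M.copies J ι active tie₀).Run x B (enc active tie₀ q' (moveInputHead x h m) c
      (Function.update l i r') (pos i (moveWorkHead z mw))) n) :
    (M.copies J ι active tie₀).Run x B
      (enc active tie₀ q h c (Function.update l i r) (pos i z)) n := by
  refine Run.det (counterAction (scanned c (Function.update l i r) (pos i z)) i v mw m q')
    (abs_workHead_enc_le hc (abs_pos_le hz)) hq ?_ ?_
  · rw [enabled_enc]
    exact ht _ (by simp [scanned, pos_self])
  · rw [exec_counterAction (r := r') (hr := by simpa [pos_self] using hr)]
    simpa [pos, pos_self] using hn

theorem run_scan_replicate {κ : Context M J ι} {i : Fin J} {b : Bool} {h n : ℕ}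
    {c : Fin J → M.Cfg} {l : Fin J → List Bool} (hc : ∀ k t, |(c k).workHead t| ≤ B)
    (r : List Bool) (d p : ℕ) (hB : p + d ≤ B)
    (hn : (M.copies J ι active tie₀).Run x B (enc active tie₀ (.scan κ i b) h c
      (Function.update l i (List.replicate (p + d) b ++ r)) (pos i (p + d : ℕ))) n) :
    (M.copies J ι active tie₀).Run x B (enc active tie₀ (.scan κ i b) h c
      (Function.update l i (List.replicate (p + d) b ++ r)) (pos i p)) n := by
  classical
  induction d generalizing p with
  | zero => exact hn
  | succ d ih =>
    have hp : listTape (List.replicate (p + (d + 1)) b ++ r) p = some b := by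
      rw [listTape_natCast, List.getElem?_append_left (by simp), List.getElem?_replicate_of_lt
        (by omega)]
    refine run_counterAction (v := some b) (mw := .right) (m := .stay) (q' := .scan κ i b)
      hc (by rw [Nat.abs_cast]; exact_mod_cast (by omega)) id ?_
      (r' := List.replicate (p + (d + 1)) b ++ r) ?_ ?_
    · intro g hg
      rw [hp] at hg
      simp only [trans, hg, if_true]
    · rw [← hp, Function.update_eq_self]
    · have := ih (p + 1) (by omega)
      rw [show p + 1 + d = p + (d + 1) by omega] at this
      simpa [moveInputHead, moveWorkHead] using this hn

/-- The state reached when the head of a counter has returned. -/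
def afterRet (κ : Context M J ι) (i : Fin J) (b f : Bool) : Control M J ι :=
  if b then .rewind κ i else if f then .scan κ i false else .act κ i

/-- Induction from the right end of `s`, in the direction in which the head travels. The blank in
cell `-1` tells the head to turn around, hence the requirement `1 ≤ B`. -/
theorem run_ret {κ : Context M J ι} {i : Fin J} {b f : Bool} {h n : ℕ}
    {c : Fin J → M.Cfg} {l : Fin J → List Bool} (hc : ∀ k t, |(c k).workHead t| ≤ B)
    (s r : List Bool) (hB : s.length ≤ B) (hB' : 1 ≤ B)
    (hn : (M.copies J ι active tie₀).Run x B (enc active tie₀ (afterRet κ i b f)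
      (moveInputHead x h (if !b && f then .right else .stay)) c
      (Function.update l i (s.map (xor · f) ++ r)) (fun _ => 0)) n) :
    (M.copies J ι active tie₀).Run x B (enc active tie₀ (.ret κ i b f) h c
      (Function.update l i (s ++ r)) (pos i (s.length - 1))) n := by
  classical
  induction s using List.reverseRecOn generalizing r with
  | nil =>
    refine run_counterAction (v := none) (mw := .right)
      (m := if !b && f then .right else .stay) (q' := afterRet κ i b f)
      hc (by simpa using hB') id ?_ (r' := r) ?_ ?_
    · intro g hg
      have hg' : (g (i, none)).1 = none := hg
      simp only [trans, hg']
      cases b <;> cases f <;> simp only [afterRet] <;> congr!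
    · exact Function.update_eq_self _ _
    · simpa [moveWorkHead, pos_zero] using hn
  | append_singleton s v ih =>
    have e : (((s ++ [v]).length : ℤ) - 1) = s.length := by simp
    have e' : s ++ [v] ++ r = s ++ v :: r := by simp
    rw [e, e']
    simp only [List.length_append, List.length_singleton] at hB
    refine run_counterAction (v := some (xor v f)) (mw := .left) (m := .stay)
      (q' := .ret κ i b f) hc (by rw [Nat.abs_cast]; exact_mod_cast (by omega)) id ?_
      (r' := s ++ xor v f :: r) ?_ ?_
    · intro g hg
      rw [listTape_append_length, List.head?_cons] at hg
      simp only [trans, hg]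
    · rw [update_listTape]; rfl
    · exact ih _ (by omega) (by simpa using hn)

/-- The carry turns `1 … 1 0` or `1 … 1` followed by a blank into `0 … 0 1`. Leading zeros are never
removed, so the invariant is a bound on the length of the digit list in addition to its value. -/
theorem run_scan_true {κ : Context M J ι} {i : Fin J} {h : ℕ}
    {c : Fin J → M.Cfg} {l : Fin J → List Bool} (hc : ∀ k t, |(c k).workHead t| ≤ B)
    (m : List Bool) (hm : m.length ≤ B) (hv : bitsVal m + 1 < 2 ^ B) :
    ∃ m' : List Bool, bitsVal m' = bitsVal m + 1 ∧ m'.length ≤ B ∧ ∀ n,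
      (M.copies J ι active tie₀).Run x B (enc active tie₀ (.rewind κ i) h c
        (Function.update l i m') (fun _ => 0)) n →
      (M.copies J ι active tie₀).Run x B (enc active tie₀ (.scan κ i true) h c
        (Function.update l i m) (fun _ => 0)) n := by
  classical
  have hB : 1 ≤ B := by
    rcases B with _ | B
    · simp at hv
    · omega
  obtain ⟨p, r, hr, hmr⟩ : ∃ p r, (r = [] ∨ r.head? = some false) ∧
      m = List.replicate p true ++ r := by
    obtain ⟨p, h | ⟨r, h⟩⟩ := exists_eq_replicate_append true m
    · exact ⟨p, [], .inl rfl, by simpa using h⟩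
    · exact ⟨p, _, .inr rfl, h⟩
  subst hmr
  have h1 := bitsVal_replicate_true_append p r
  refine ⟨List.replicate p false ++ true :: r.tail, ?_, ?_, fun n hn => ?_⟩
  · rw [h1, bitsVal_replicate_false_append]
    rcases r with _ | ⟨b, r⟩
    · rfl
    · obtain rfl : b = false := by simpa using hr
      simp only [bitsVal, List.tail_cons, Bool.toNat_true, Bool.toNat_false]
      ring
  -- The list grows only if all its `p` digits are 1; then its value plus one is `2 ^ p`, and `hv`
  -- gives `p < B`.
  · rcases r with _ | ⟨b, r⟩
    · rw [h1] at hv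
      have := (Nat.pow_lt_pow_iff_right (a := 2) (by norm_num)).1
        (by simpa [bitsVal] using hv : 2 ^ p < 2 ^ B)
      simpa using this
    · simpa using hm
  · have hp : p ≤ B := by simp at hm; omega
    rw [← pos_zero i]
    have := run_scan_replicate (active := active) (tie₀ := tie₀) (x := x) (κ := κ) (i := i)
      (b := true) (h := h) (n := n) (l := l) hc r p 0 (by omega)
    simp only [zero_add, Nat.cast_zero] at this
    refine this ?_
    have hl : ((List.replicate p true).length : ℤ) = p := by simp
    refine run_counterAction (v := some true) (mw := .left) (m := .stay)
      (q' := .ret κ i true true) hc (by rw [Nat.abs_cast]; exact_mod_cast hp) id ?_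
      (r' := List.replicate p true ++ true :: r.tail) ?_ ?_
    · intro g hg
      rw [← hl, listTape_append_length] at hg
      have : (g (i, none)).1 ≠ some true := by
        rw [hg]; rcases hr with rfl | hr <;> simp_all
      simp only [trans, this, if_false]
      simp only [Bool.true_eq_false, and_false, if_false]
    · rw [← hl, update_listTape]
    · have := run_ret (active := active) (tie₀ := tie₀) (x := x) (κ := κ) (i := i)
        (b := true) (f := true) (h := h) (n := n) (l := l) hc (List.replicate p true)
        (true :: r.tail) (by simpa using hp) hB
      rw [hl] at this
      exact this (by simpa [afterRet, moveInputHead] using hn)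

theorem run_scan_false {κ : Context M J ι} {i : Fin J} {h : ℕ}
    {c : Fin J → M.Cfg} {l : Fin J → List Bool} (hc : ∀ k t, |(c k).workHead t| ≤ B)
    (m : List Bool) (hm : m.length ≤ B) (hv : bitsVal m ≠ 0) :
    ∃ m' : List Bool, bitsVal m' + 1 = bitsVal m ∧ m'.length ≤ B ∧ ∀ n,
      (M.copies J ι active tie₀).Run x B (enc active tie₀ (.scan κ i false)
        (moveInputHead x h .right) c (Function.update l i m') (fun _ => 0)) n →
      (M.copies J ι active tie₀).Run x B (enc active tie₀ (.scan κ i false) h c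
        (Function.update l i m) (fun _ => 0)) n := by
  classical
  obtain ⟨p, rfl | ⟨r, rfl⟩⟩ := exists_eq_replicate_append false m
  · have := bitsVal_replicate_false_append p []
    simp [bitsVal] at this hv
    exact absurd this hv
  have hm' : p + (r.length + 1) ≤ B := by simpa using hm
  refine ⟨List.replicate p true ++ false :: r, ?_, by simpa using hm, fun n hn => ?_⟩
  · rw [bitsVal_replicate_true_append, bitsVal_replicate_false_append]
    simp only [bitsVal, Bool.not_false, Bool.toNat_true, Bool.toNat_false]
    ring
  · rw [← pos_zero i]
    have := run_scan_replicate (active := active) (tie₀ := tie₀) (x := x) (κ := κ) (i := i)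
      (b := false) (h := h) (n := n) (l := l) hc ((!false) :: r) p 0 (by omega)
    simp only [zero_add, Nat.cast_zero] at this
    refine this ?_
    have hl : ((List.replicate p false).length : ℤ) = p := by simp
    refine run_counterAction (v := some false) (mw := .left) (m := .stay)
      (q' := .ret κ i false true) hc (by rw [Nat.abs_cast]; exact_mod_cast (by omega)) id ?_
      (r' := List.replicate p false ++ false :: r) ?_ ?_
    · intro g hg
      rw [← hl, listTape_append_length] at hg
      simp only [trans, hg]
      simp only [List.head?_cons, Bool.not_false, Option.some.injEq, Bool.true_eq_false, if_false,
        reduceCtorEq, false_and]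
    · rw [← hl, update_listTape]; rfl
    · have := run_ret (active := active) (tie₀ := tie₀) (x := x) (κ := κ) (i := i)
        (b := false) (f := true) (h := h) (n := n) (l := l) hc (List.replicate p false)
        (false :: r) (by simp; omega) (by omega)
      rw [hl] at this
      exact this (by simpa [afterRet, moveInputHead] using hn)

theorem run_scan_false_of_eq_zero {κ : Context M J ι} {i : Fin J} {h n : ℕ}
    {c : Fin J → M.Cfg} {l : Fin J → List Bool} (hc : ∀ k t, |(c k).workHead t| ≤ B)
    (hB : 1 ≤ B) (m : List Bool) (hm : m.length ≤ B) (hv : bitsVal m = 0)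
    (hn : (M.copies J ι active tie₀).Run x B (enc active tie₀ (.act κ i) h c
        (Function.update l i m) (fun _ => 0)) n) :
    (M.copies J ι active tie₀).Run x B (enc active tie₀ (.scan κ i false) h c
        (Function.update l i m) (fun _ => 0)) n := by
  classical
  obtain ⟨p, rfl | ⟨r, rfl⟩⟩ := exists_eq_replicate_append false m
  swap
  · rw [bitsVal_replicate_false_append] at hv
    simp [bitsVal] at hv
  have hp : p ≤ B := by simpa using hm
  rw [← pos_zero i]
  have := run_scan_replicate (active := active) (tie₀ := tie₀) (x := x) (κ := κ) (i := i)
    (b := false) (h := h) (n := n) (l := l) hc [] p 0 (by omega)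
  simp only [zero_add, Nat.cast_zero, List.append_nil] at this
  refine this ?_
  have hl : ((List.replicate p false).length : ℤ) = p := by simp
  have hp' : listTape (List.replicate p false) p = none := by
    rw [listTape_natCast]; simp
  refine run_counterAction (v := none) (mw := .left) (m := .stay)
    (q' := .ret κ i false false) hc (by rw [Nat.abs_cast]; exact_mod_cast hp) id ?_
    (r' := List.replicate p false) ?_ ?_
  · intro g hg
    rw [hp'] at hg
    simp only [trans, hg]
    simp only [reduceCtorEq, if_false, and_self, if_true]
  · rw [← hp', Function.update_eq_self]
  · have := run_ret (active := active) (tie₀ := tie₀) (x := x) (κ := κ) (i := i)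
      (b := false) (f := false) (h := h) (n := n) (l := l) hc (List.replicate p false)
      [] (by simp; omega) (by omega)
    rw [hl] at this
    simp only [List.append_nil] at this
    exact this (by simpa [afterRet, moveInputHead] using hn)

/-- Moving the input head to the position held by a counter. -/
theorem run_load {κ : Context M J ι} {i : Fin J} {c : Fin J → M.Cfg} {l : Fin J → List Bool}
    (hc : ∀ k t, |(c k).workHead t| ≤ B) (hB : 1 ≤ B) (m : List Bool) (hm : m.length ≤ B)
    (h : ℕ) (hh : h + bitsVal m ≤ x.length + 1) :
    ∃ m' : List Bool, bitsVal m' = 0 ∧ m'.length ≤ B ∧ ∀ n,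
      (M.copies J ι active tie₀).Run x B (enc active tie₀ (.act κ i) (h + bitsVal m) c
        (Function.update l i m') (fun _ => 0)) n →
      (M.copies J ι active tie₀).Run x B (enc active tie₀ (.scan κ i false) h c
        (Function.update l i m) (fun _ => 0)) n := by
  induction v : bitsVal m generalizing m h with
  | zero => exact ⟨m, v, hm, fun n hn => run_scan_false_of_eq_zero hc hB m hm v hn⟩
  | succ v' ih =>
    obtain ⟨m₁, h1, h2, h3⟩ := run_scan_false (active := active) (tie₀ := tie₀) (x := x) (κ := κ)
      (i := i) (h := h) (l := l) hc m hm (by omega)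
    obtain ⟨m', h4, h5, h6⟩ := ih m₁ h2 (h + 1) (by omega) (by omega)
    refine ⟨m', h4, h5, fun n hn => h3 n ?_⟩
    -- By `hh` the head stays on the tape, so the truncation at the right end marker has no effect.
    rw [moveInputHead, min_eq_left (by omega)]
    exact h6 n (by rwa [add_right_comm, add_assoc])

/-- Moving the input head back to the left end marker, and saving its position in a counter. -/
theorem run_rewind {κ : Context M J ι} {i : Fin J} {c : Fin J → M.Cfg} {l : Fin J → List Bool}
    (hc : ∀ k t, |(c k).workHead t| ≤ B) (m : List Bool) (hm : m.length ≤ B)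
    (h : ℕ) (hh : bitsVal m + h < 2 ^ B) :
    ∃ m' : List Bool, bitsVal m' = bitsVal m + h ∧ m'.length ≤ B ∧ ∀ n,
      (M.copies J ι active tie₀).Run x B (enc active tie₀ (.next κ i.succ) 0 c
        (Function.update l i m') (fun _ => 0)) n →
      (M.copies J ι active tie₀).Run x B (enc active tie₀ (.rewind κ i) h c
        (Function.update l i m) (fun _ => 0)) n := by
  induction h generalizing m with
  | zero =>
    refine ⟨m, rfl, hm, fun n hn => run_idle (m := .stay) (q' := .next κ i.succ) hc id ?_ hn⟩
    simp [trans, inputSymbol]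
  | succ h ih =>
    obtain ⟨m₁, h1, h2, h3⟩ := run_scan_true (active := active) (tie₀ := tie₀) (x := x) (κ := κ)
      (i := i) (h := h) (l := l) hc m hm (by omega)
    obtain ⟨m', h4, h5, h6⟩ := ih m₁ h2 (by omega)
    refine ⟨m', by omega, h5, fun n hn =>
      run_idle (m := .left) (q' := .scan κ i true) hc id ?_ (h3 n (h6 n hn))⟩
    have : inputSymbol x (h + 1) ≠ .leftEnd := by
      simp only [inputSymbol]
      cases x[h]? <;> simp
    simp [trans, this]

end Copies

end NTM

/-! ### One round of the simulation -/

namespace NTM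

variable {α : Type}

namespace Copies

section Round

variable {M : NTM α} [LT M.Action] {J : ℕ} {ι : Type} [Finite ι]
  {active : ι → Fin J → Prop} {tie₀ : ι → Fin J → Fin J → Prop} {x : List α} {B : ℕ}

/-- The configuration after executing an instruction, if any. -/
def advanceCfg (x : List α) (u : Option M.Action) (c : M.Cfg) : M.Cfg :=
  u.elim c (M.exec x c)

/-- The control state and the counters agree with the configurations `c` of the copies. -/
def Stored (x : List α) (B : ℕ) (st : Fin J → M.State) (c : Fin J → M.Cfg)
    (l : Fin J → List Bool) : Prop :=
  ∀ k, st k = (c k).state ∧ M.Reachable x (c k) ∧ bitsVal (l k) = (c k).inputHead ∧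
    (l k).length ≤ B

omit [LT M.Action] [Finite ι] in
theorem reachable_advanceCfg {κ : Context M J ι} {i : Fin J} {c : M.Cfg}
    (hc : M.Reachable x c) (hv : κ.Valid active i (M.enabled x c)) :
    M.Reachable x (advanceCfg x (κ.guess i) c) := by
  unfold Context.Valid at hv
  cases hu : κ.guess i with
  | none => exact hc
  | some a =>
    rw [hu] at hv
    exact hc.exec hv.2

theorem run_act {κ : Context M J ι} {i : Fin J} {c : Fin J → M.Cfg} {l : Fin J → List Bool}
    {n : ℕ} (hc : ∀ k t, |(c k).workHead t| ≤ B) (hst : κ.st i = (c i).state)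
    (hv : κ.Valid active i (M.enabled x (c i)))
    (hn : (M.copies J ι active tie₀).Run x B (enc active tie₀ (.rewind (κ.advance i) i)
      (advanceCfg x (κ.guess i) (c i)).inputHead
      (Function.update c i (advanceCfg x (κ.guess i) (c i))) l fun _ => 0) n) :
    (M.copies J ι active tie₀).Run x B
      (enc active tie₀ (.act κ i) (c i).inputHead c l fun _ => 0) n := by
  rw [enabled, ← hst] at hv
  cases hu : κ.guess i with
  | none =>
    refine Run.det (idle (scanned c l fun _ => 0) .stay (.rewind (κ.advance i) i))
      (abs_workHead_enc_le hc (by simp)) id ?_ ?_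
    · rw [enabled_enc]
      exact (if_pos hv).trans (by rw [hu]; rfl)
    · rw [exec_idle]
      simpa [hu, advanceCfg, moveInputHead] using hn
  | some a =>
    refine Run.det (copyAction (scanned c l fun _ => 0) i a (.rewind (κ.advance i) i))
      (abs_workHead_enc_le hc (by simp)) id ?_ ?_
    · rw [enabled_enc]
      exact (if_pos hv).trans (by rw [hu]; rfl)
    · rw [exec_copyAction]
      rw [hu] at hn
      exact hn

theorem run_act_of_not_valid {κ : Context M J ι} {i : Fin J} {c : Fin J → M.Cfg}
    {l : Fin J → List Bool} (hc : ∀ k t, |(c k).workHead t| ≤ B) (hst : κ.st i = (c i).state)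
    (hv : ¬ κ.Valid active i (M.enabled x (c i))) :
    (M.copies J ι active tie₀).Run x B
      (enc active tie₀ (.act κ i) (c i).inputHead c l fun _ => 0) 0 := by
  rw [enabled, ← hst] at hv
  refine Run.reject (abs_workHead_enc_le hc (by simp)) id ?_
  rw [enabled_enc]
  exact if_neg hv

variable (hB : x.length + 1 < 2 ^ B) (hM : ∀ c, M.Reachable x c → ∀ t, |c.workHead t| ≤ B)
include hB hM

open Classical in
/-- Executing the guessed instruction of copy `i`. -/
theorem run_copy {κ : Context M J ι} {i : Fin J} {c : Fin J → M.Cfg} {l : Fin J → List Bool}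
    {n : ℕ} (hs : Stored x B κ.st c l)
    (hn : κ.Valid active i (M.enabled x (c i)) → ∀ l',
      Stored x B (κ.advance i).st (Function.update c i (advanceCfg x (κ.guess i) (c i))) l' →
      (M.copies J ι active tie₀).Run x B (enc active tie₀ (.next (κ.advance i) i.succ) 0
        (Function.update c i (advanceCfg x (κ.guess i) (c i))) l' fun _ => 0) n) :
    (M.copies J ι active tie₀).Run x B
      (enc active tie₀ (.next κ i.castSucc) 0 c l fun _ => 0)
      (if κ.Valid active i (M.enabled x (c i)) then n else 0) := by
  have hc : ∀ k t, |(c k).workHead t| ≤ B := fun k => hM _ (hs k).2.1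
  have hB1 : 1 ≤ B := by
    rcases B with _ | B
    · simp at hB
    · omega
  obtain ⟨h1, h2, h3, h4⟩ := hs i
  have h5 := h2.inputHead_le
  refine run_idle (m := .stay) (q' := .scan κ i false) hc ?_ ?_ ?_
  · rintro ⟨h, -⟩
    exact absurd h i.2.ne
  · simp [trans]
  obtain ⟨m, h6, h7, h8⟩ := run_load (active := active) (tie₀ := tie₀) (x := x) (κ := κ) (i := i)
    (l := l) hc hB1 (l i) h4 0 (by omega)
  rw [Function.update_eq_self, zero_add, h3] at h8
  refine h8 _ ?_
  split_ifs with hv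
  · refine run_act hc h1 hv ?_
    have hr := reachable_advanceCfg h2 hv
    have h9 := hr.inputHead_le
    have hc' : ∀ k t, |(Function.update c i (advanceCfg x (κ.guess i) (c i)) k).workHead t| ≤ B := by
      intro k
      by_cases hk : k = i
      · subst hk
        rw [Function.update_self]
        exact hM _ hr
      · rw [Function.update_of_ne hk]
        exact hc k
    obtain ⟨m', h10, h11, h12⟩ := run_rewind (active := active) (tie₀ := tie₀) (x := x)
      (κ := κ.advance i) (i := i) (l := l) hc' m h7
      (advanceCfg x (κ.guess i) (c i)).inputHead (by omega)
    refine h12 _ (hn hv _ ?_)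
    intro k
    by_cases hk : k = i
    · subst hk
      simp only [Context.advance, Function.update_self]
      refine ⟨?_, hr, by omega, h11⟩
      cases κ.guess k
      · exact h1
      · rfl
    · simp only [Context.advance, Function.update_of_ne hk]
      exact hs k
  · exact run_act_of_not_valid hc h1 hv

open Classical in
/-- Executing the guessed instructions of the copies `i, i + 1, …`. -/
theorem run_round {n : ℕ} (i : Fin (J + 1)) {κ : Context M J ι} {c : Fin J → M.Cfg}
    {l : Fin J → List Bool} (hs : Stored x B κ.st c l)
    (c' : Fin J → M.Cfg)
    (hc' : ∀ k, c' k = if i ≤ k.castSucc then advanceCfg x (κ.guess k) (c k) else c k)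
    (hn : (∀ k, i ≤ k.castSucc → κ.Valid active k (M.enabled x (c k))) → ∀ l',
      Stored x B (fun k => (c' k).state) c' l' →
      (M.copies J ι active tie₀).Run x B (enc active tie₀
        (.next { κ with st := fun k => (c' k).state } (Fin.last J)) 0 c' l' fun _ => 0) n) :
    (M.copies J ι active tie₀).Run x B (enc active tie₀ (.next κ i) 0 c l fun _ => 0)
      (if ∀ k, i ≤ k.castSucc → κ.Valid active k (M.enabled x (c k)) then n else 0) := by
  induction i using Fin.reverseInduction generalizing κ c l with
  | last =>
    have hlt (k : Fin J) : ¬ Fin.last J ≤ k.castSucc := not_le.2 k.castSucc_lt_last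
    obtain rfl : c' = c := by
      funext k
      rw [hc', if_neg (hlt k)]
    have hv : ∀ k, Fin.last J ≤ k.castSucc → κ.Valid active k (M.enabled x (c' k)) :=
      fun k hk => absurd hk (hlt k)
    rw [if_pos hv]
    have hst : (fun k => (c' k).state) = κ.st := funext fun k => (hs k).1.symm
    rw [hst] at hn
    exact hn hv l hs
  | cast i ih =>
    have hlt (k : Fin J) : i.succ ≤ k.castSucc ↔ i < k := Iff.rfl
    have key : (∀ k, i.castSucc ≤ k.castSucc → κ.Valid active k (M.enabled x (c k))) ↔
        κ.Valid active i (M.enabled x (c i)) ∧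
        ∀ k, i.succ ≤ k.castSucc → (κ.advance i).Valid active k
          (M.enabled x (Function.update c i (advanceCfg x (κ.guess i) (c i)) k)) := by
      constructor
      · intro h
        refine ⟨h i le_rfl, fun k hk => ?_⟩
        have hki := (hlt k).1 hk
        rw [Function.update_of_ne hki.ne']
        exact h k (by simpa using hki.le)
      · rintro ⟨h1, h2⟩ k hk
        rcases (Fin.castSucc_le_castSucc_iff.1 hk).eq_or_lt with rfl | hki
        · exact h1
        · have := h2 k ((hlt k).2 hki)
          rwa [Function.update_of_ne hki.ne'] at this
    -- The nested conditional matches the machine: `run_copy` accounts for the test on copy `i`, and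
    -- the induction hypothesis for the tests on the later copies. Updating copy `i` does not affect
    -- those.
    rw [if_congr key rfl rfl, ite_and]
    refine run_copy hB hM hs fun hv l' hs' => ih hs' ?_ ?_
    · intro k
      rw [hc' k]
      by_cases hk : k = i
      · subst hk
        simp [Fin.le_def]
      · rw [Function.update_of_ne hk]
        have : i.succ ≤ k.castSucc ↔ i.castSucc ≤ k.castSucc := by
          have : (k : ℕ) ≠ i := fun h => hk (Fin.ext h)
          simp only [Fin.le_def, Fin.val_succ, Fin.val_castSucc]
          omega
        exact if_congr this.symm rfl rfl
    · intro hv' l'' hs''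
      exact hn (key.2 ⟨hv, hv'⟩) l'' hs''

end Round

/-! ### Counting increasing tuples of branches by their first instructions -/

section Count

variable {M : NTM α} {J : ℕ}

/-- Tuples of accepting branches, one for every active copy, that are increasing for the pairs of
copies in `tie`. -/
def branchTuples (M : NTM α) [LT M.Action] (x : List α) (act : Fin J → Prop)
    (tie : Fin J → Fin J → Prop) (c : Fin J → M.Cfg) : Set (Fin J → List M.Action) :=
  {b | (∀ i, (act i → M.IsAcceptingBranch x (c i) (b i)) ∧ (¬ act i → b i = [])) ∧
    ∀ i j, tie i j → b i < b j}

theorem finite_branchTuples [LT M.Action] {x : List α} (act : Fin J → Prop)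
    (tie : Fin J → Fin J → Prop) {c : Fin J → M.Cfg} (t : Fin J → ℕ)
    (hc : ∀ i, M.HaltsWithin x (t i) (c i)) : (branchTuples M x act tie c).Finite := by
  refine (Set.Finite.pi' (t := fun i => {b | M.IsAcceptingBranch x (c i) b} ∪ {[]})
    fun i => (finite_isAcceptingBranch (hc i)).union (Set.finite_singleton _)).subset ?_
  intro b hb i
  by_cases h : act i
  · exact .inl ((hb.1 i).1 h)
  · exact .inr ((hb.1 i).2 h)

/-- One step of the lexicographic comparison, with `none` (a branch that is over) below every
instruction. This is what allows the order of branches to be checked round by round. The hypotheses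
exclude that a branch continues after `none`. -/
theorem toList_append_lt_toList_append {β : Type} [LinearOrder β] {o o' : Option β} {l l' : List β}
    (h : o = none → l = []) (h' : o' = none → l' = []) :
    o.toList ++ l < o'.toList ++ l' ↔ o < o' ∨ o = o' ∧ l < l' := by
  rcases o with _ | a <;> rcases o' with _ | a'
  · simp [h rfl, h' rfl]
  · simp [h rfl]
  · simp [h' rfl]
  · simp [List.cons_lt_cons_iff]

theorem not_lt_self_option {β : Type} [Preorder β] (o : Option β) : ¬ o < o := by
  cases o <;> simp

theorem exists_eq_toList_append {β : Type} (l : List β) : l = l.head?.toList ++ l.tail := by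
  cases l <;> simp

variable [LinearOrder M.Action] {x : List α} {ι : Type} {active : ι → Fin J → Prop}

omit [LinearOrder M.Action] in
theorem eq_nil_of_valid {κ : Context M J ι} {i : Fin J} {c : M.Cfg} {b : List M.Action}
    (hv : κ.Valid active i (M.enabled x c)) (hu : κ.guess i = none)
    (h1 : active κ.idx i → M.IsAcceptingBranch x c b) (h2 : ¬ active κ.idx i → b = []) :
    b = [] := by
  by_cases h : active κ.idx i
  · have h3 := h1 h
    simp only [Context.Valid, hu] at hv
    cases b with
    | nil => rfl
    | cons a b => simp [IsAcceptingBranch, hv h] at h3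
  · exact h2 h

/-- Tuples of branches that begin with the guessed instructions correspond to tuples of branches
from the configurations reached. -/
theorem setOf_branchTuples_head?_eq {κ : Context M J ι} {tie : Fin J → Fin J → Prop}
    {c : Fin J → M.Cfg} (hv : ∀ i, κ.Valid active i (M.enabled x (c i)))
    (hu : Compatible tie κ.guess) :
    {b ∈ branchTuples M x (active κ.idx) tie c | (fun i => (b i).head?) = κ.guess} =
      (fun b i => (κ.guess i).toList ++ b i) '' branchTuples M x (active κ.idx)
        (nextTie tie κ.guess) (fun i => advanceCfg x (κ.guess i) (c i)) := by
  ext b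
  constructor
  · rintro ⟨⟨h1, h2⟩, h3⟩
    have h3' : ∀ i, (b i).head? = κ.guess i := congrFun h3
    have h4 : ∀ i, b i = (κ.guess i).toList ++ (b i).tail := fun i => by
      rw [← h3']; exact exists_eq_toList_append _
    have h5 : ∀ i, κ.guess i = none → (b i).tail = [] := fun i hi => by
      rw [eq_nil_of_valid (hv i) hi (h1 i).1 (h1 i).2]; rfl
    refine ⟨fun i => (b i).tail, ⟨fun i => ⟨fun ha => ?_, fun ha => ?_⟩, ?_⟩, ?_⟩
    · have h6 := (h1 i).1 ha
      rw [h4 i] at h6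
      cases hi : κ.guess i with
      | none => simpa [hi, advanceCfg] using h6
      | some a =>
        simp only [hi, Option.toList_some, List.singleton_append, IsAcceptingBranch] at h6
        simpa [hi, advanceCfg] using h6.2
    · simp [(h1 i).2 ha]
    · rintro i j ⟨hij, hij'⟩
      have h6 := h2 i j hij
      rw [h4 i, h4 j, toList_append_lt_toList_append (h5 i) (h5 j), hij'] at h6
      exact (h6.resolve_left (not_lt_self_option _)).2
    · exact funext fun i => (h4 i).symm
  · rintro ⟨b, ⟨h1, h2⟩, rfl⟩
    have h5 : ∀ i, κ.guess i = none → b i = [] := fun i hi => by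
      have := h1 i
      simp only [hi, advanceCfg, Option.elim_none] at this
      exact eq_nil_of_valid (hv i) hi this.1 this.2
    refine ⟨⟨fun i => ⟨fun ha => ?_, fun ha => ?_⟩, ?_⟩, ?_⟩
    · have h6 := (h1 i).1 ha
      have h7 := hv i
      simp only [Context.Valid] at h7
      cases hi : κ.guess i with
      | none => simpa [hi, advanceCfg] using h6
      | some a =>
        simp only [hi, advanceCfg, Option.elim_some] at h7 h6
        simpa [hi, IsAcceptingBranch] using ⟨h7.2, h6⟩
    · have h7 := hv i
      simp only [Context.Valid] at h7
      cases hi : κ.guess i with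
      | none => simp [h5 i hi, hi]
      | some a =>
        rw [hi] at h7
        exact absurd h7.1 ha
    · intro i j hij
      simp only
      rw [toList_append_lt_toList_append (h5 i) (h5 j)]
      rcases hu i j hij with h | h
      · exact .inl h
      · exact .inr ⟨h, h2 i j ⟨hij, h⟩⟩
    · funext i
      cases hi : κ.guess i with
      | none => simp [h5 i hi, hi]
      | some a => simp [hi]

theorem ncard_branchTuples_head?_eq {κ : Context M J ι} {tie : Fin J → Fin J → Prop}
    {c : Fin J → M.Cfg} (hv : ∀ i, κ.Valid active i (M.enabled x (c i)))
    (hu : Compatible tie κ.guess) :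
    {b ∈ branchTuples M x (active κ.idx) tie c | (fun i => (b i).head?) = κ.guess}.ncard =
      (branchTuples M x (active κ.idx) (nextTie tie κ.guess)
        (fun i => advanceCfg x (κ.guess i) (c i))).ncard := by
  rw [setOf_branchTuples_head?_eq hv hu]
  refine Set.ncard_image_of_injective _ fun b b' h => ?_
  funext i
  exact List.append_cancel_left (congrFun h i)

/-- Used in contrapositive form: an invalid guess is not the beginning of any tuple, so it rightly
contributes 0. -/
theorem valid_of_mem_branchTuples {κ : Context M J ι} {tie : Fin J → Fin J → Prop}
    {c : Fin J → M.Cfg} {b : Fin J → List M.Action}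
    (hb : b ∈ branchTuples M x (active κ.idx) tie c) (h : (fun i => (b i).head?) = κ.guess)
    (i : Fin J) : κ.Valid active i (M.enabled x (c i)) := by
  obtain ⟨h1, h2⟩ := hb.1 i
  simp only [Context.Valid, ← h]
  cases hi : b i with
  | nil =>
    intro ha
    have := h1 ha
    rw [hi] at this
    exact this.1
  | cons a l =>
    have ha : active κ.idx i := by
      by_contra ha
      simp [h2 ha] at hi
    have := h1 ha
    rw [hi] at this
    exact ⟨ha, this.1⟩

theorem compatible_of_mem_branchTuples {act : Fin J → Prop} {tie : Fin J → Fin J → Prop}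
    {c : Fin J → M.Cfg} {b : Fin J → List M.Action}
    (hb : b ∈ branchTuples M x act tie c) :
    Compatible tie (fun i => (b i).head?) := by
  intro i j hij
  have h := hb.2 i j hij
  rw [exists_eq_toList_append (b i), exists_eq_toList_append (b j),
    toList_append_lt_toList_append (by simp_all) (by simp_all)] at h
  exact h.imp_right And.left

-- From halting configurations only the empty branch is possible, so the only candidate is the
-- constant tuple, and it violates every remaining strict inequality. This is why acceptance
-- requires that no pair is still tied.
open Classical in
theorem ncard_branchTuples_of_halted {act : Fin J → Prop} {tie : Fin J → Fin J → Prop}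
    {c : Fin J → M.Cfg} (hc : ∀ i, act i → M.enabled x (c i) = ∅) :
    (branchTuples M x act tie c).ncard =
      if (∀ i j, ¬ tie i j) ∧ ∀ i, act i → (c i).state ∈ M.accept then 1 else 0 := by
  have h0 : ∀ b ∈ branchTuples M x act tie c, b = fun _ => [] := by
    intro b hb
    funext i
    by_cases h : act i
    · have := (hb.1 i).1 h
      cases hi : b i with
      | nil => rfl
      | cons a l => rw [hi] at this; simp [IsAcceptingBranch, hc i h] at this
    · exact (hb.1 i).2 h
  split_ifs with h
  · rw [Set.ncard_eq_one]
    refine ⟨fun _ => [], Set.eq_singleton_iff_unique_mem.2 ⟨⟨fun i => ⟨fun ha => ?_, fun _ => rfl⟩,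
      fun i j hij => absurd hij (h.1 i j)⟩, h0⟩⟩
    exact ⟨hc i ha, h.2 i ha⟩
  · rw [Set.eq_empty_of_forall_notMem (s := branchTuples M x act tie c), Set.ncard_empty]
    refine fun b hb => h ⟨fun i j hij => ?_, fun i ha => ?_⟩
    · have := hb.2 i j hij
      simp [h0 b hb] at this
    · have := (hb.1 i).1 ha
      rw [h0 b hb] at this
      exact this.2

/-- The tuples are partitioned by the vector of their first instructions, which is compatible for
every increasing tuple, so no fibre is missed. -/
theorem sum_ncard_branchTuples {act : Fin J → Prop} {tie : Fin J → Fin J → Prop}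
    {c : Fin J → M.Cfg} (hf : (branchTuples M x act tie c).Finite)
    (s : Finset (Fin J → Option M.Action)) (hs : ∀ u, u ∈ s ↔ Compatible tie u) :
    ∑ u ∈ s, {b ∈ branchTuples M x act tie c | (fun i => (b i).head?) = u}.ncard =
      (branchTuples M x act tie c).ncard := by
  classical
  rw [Set.ncard_eq_toFinset_card _ hf, Finset.card_eq_sum_card_fiberwise
    (f := fun b i => (b i).head?) (t := s)]
  · refine Finset.sum_congr rfl fun u _ => ?_
    rw [← Set.ncard_coe_finset]
    congr 1
    ext b
    simp
  · intro b hb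
    exact (hs _).2 (compatible_of_mem_branchTuples (by simpa using hb))

end Count

end Copies

end NTM

/-! ### The number of accepting branches of the simulating machine -/

namespace NTM

variable {α : Type}

namespace Copies

variable {M : NTM α} [LinearOrder M.Action] {J : ℕ} {ι : Type} [Finite ι]
  {active : ι → Fin J → Prop} {tie₀ : ι → Fin J → Fin J → Prop} {x : List α} {B : ℕ}

-- The termination measure: a copy that executes an instruction loses at least one step of its
-- remaining time, and a copy that stays gains none.
omit [LinearOrder M.Action] [Finite ι] in
theorem exists_haltsWithin_advanceCfg {κ : Context M J ι} {i : Fin J} {c : M.Cfg} {t : ℕ}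
    (hc : M.HaltsWithin x t c) (hv : κ.Valid active i (M.enabled x c)) :
    ∃ t' ≤ t, M.HaltsWithin x t' (advanceCfg x (κ.guess i) c) ∧ (κ.guess i ≠ none → t' < t) := by
  simp only [Context.Valid] at hv
  cases hi : κ.guess i with
  | none => exact ⟨t, le_rfl, hc, fun h => absurd rfl h⟩
  | some a =>
    rw [hi] at hv
    cases t with
    | zero =>
      rw [HaltsWithin] at hc
      simp [hc] at hv
    | succ t => exact ⟨t, t.le_succ, hc a hv.2, fun _ => t.lt_succ_self⟩

-- The guess is recorded in the next state, so different guesses are different instructions and are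
-- counted as different branches.
omit [LinearOrder M.Action] [Finite ι] in
theorem idle_next_injective (g : CopyTape M J → Symbol M) (k : ι) (st : Fin J → M.State)
    (tie : Fin J → Fin J → Prop) :
    Function.Injective fun u : Fin J → Option M.Action =>
      idle g .stay (.next (⟨k, st, nextTie tie u, u⟩ : Context M J ι) 0) := by
  intro u v h
  simp only [idle, NTMAction.mk.injEq, Control.next.injEq, Context.mk.injEq] at h
  exact h.1.1.2.2.2

theorem enc_next_last_run {κ : Context M J ι} {c : Fin J → M.Cfg} {l : Fin J → List Bool}
    {n : ℕ} (hc : ∀ k t, |(c k).workHead t| ≤ B) (hu : ∃ j, κ.guess j ≠ none)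
    (hn : (M.copies J ι active tie₀).Run x B
      (enc active tie₀ (.main κ.idx κ.st κ.tie) 0 c l fun _ => 0) n) :
    (M.copies J ι active tie₀).Run x B
      (enc active tie₀ (.next κ (Fin.last J)) 0 c l fun _ => 0) n := by
  refine run_idle (m := .stay) (q' := .main κ.idx κ.st κ.tie) hc ?_ ?_ hn
  · rintro ⟨-, h, -⟩
    exact hu.elim fun j hj => hj (h j)
  · simp only [trans, Fin.val_last, lt_irrefl, dite_false]
    exact if_pos hu

open Classical in
theorem enc_next_last_run_of_guess_eq_none {κ : Context M J ι} {c : Fin J → M.Cfg}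
    {l : Fin J → List Bool} (hc : ∀ k t, |(c k).workHead t| ≤ B) (hu : ∀ j, κ.guess j = none) :
    (M.copies J ι active tie₀).Run x B
      (enc active tie₀ (.next κ (Fin.last J)) 0 c l fun _ => 0)
      (if (∀ j k, ¬ κ.tie j k) ∧ ∀ j, active κ.idx j → κ.st j ∈ M.accept then 1 else 0) := by
  have he : (M.copies J ι active tie₀).enabled x
      (enc active tie₀ (.next κ (Fin.last J)) 0 c l fun _ => 0) = ∅ := by
    rw [enabled_enc]
    simp only [trans, Fin.val_last, lt_irrefl, dite_false]
    exact if_neg (by simpa using hu)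
  split_ifs with h
  · exact Run.accept _ (abs_workHead_enc_le hc (by simp)) he ⟨rfl, hu, h⟩
  · exact Run.reject (abs_workHead_enc_le hc (by simp)) (fun h' => h h'.2.2) he

/-- The machine counts tuples of branches. -/
theorem run_main (hB : x.length + 1 < 2 ^ B)
    (hM : ∀ c, M.Reachable x c → ∀ t, |c.workHead t| ≤ B) (k : ι) (T : ℕ)
    {tie : Fin J → Fin J → Prop} {st : Fin J → M.State} {c : Fin J → M.Cfg}
    {l : Fin J → List Bool} (hs : Stored x B st c l) (t : Fin J → ℕ)
    (ht : ∀ i, M.HaltsWithin x (t i) (c i)) (hT : ∑ i, t i ≤ T) :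
    (M.copies J ι active tie₀).Run x B (enc active tie₀ (.main k st tie) 0 c l fun _ => 0)
      (branchTuples M x (active k) tie c).ncard := by
  classical
  induction T using Nat.strong_induction_on generalizing tie st c l t with
  | _ T ih =>
  have hc : ∀ k t, |(c k).workHead t| ≤ B := fun k => hM _ (hs k).2.1
  have := Fintype.ofFinite (Fin J → Option M.Action)
  rw [← sum_ncard_branchTuples (finite_branchTuples _ _ t ht)
    (Finset.univ.filter fun u => Compatible tie u) (by simp)]
  refine Run.branch _ _ (idle_next_injective (scanned c l fun _ => 0) k st tie) _
    (abs_workHead_enc_le hc (by simp)) id ?_ ?_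
  · intro a
    rw [enabled_enc]
    simp only [Finset.mem_filter, Finset.mem_univ, true_and]
    exact Iff.rfl
  intro u hu
  replace hu : Compatible tie u := (Finset.mem_filter.1 hu).2
  rw [exec_idle]
  set κ : Context M J ι := ⟨k, st, nextTie tie u, u⟩ with hκ
  have hround := run_round (active := active) (tie₀ := tie₀) hB hM 0 (κ := κ) hs
    (fun i => advanceCfg x (u i) (c i)) (fun i => by simp [hκ])
    (n := {b ∈ branchTuples M x (active k) tie c | (fun i => (b i).head?) = u}.ncard)
  -- Brings the count into the form delivered by `run_round`: for an invalid guess the fibre is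
  -- empty.
  have hite : {b ∈ branchTuples M x (active k) tie c | (fun i => (b i).head?) = u}.ncard =
      if ∀ i : Fin J, 0 ≤ i.castSucc → κ.Valid active i (M.enabled x (c i)) then
        {b ∈ branchTuples M x (active k) tie c | (fun i => (b i).head?) = u}.ncard else 0 := by
    split_ifs with h
    · rfl
    · rw [Set.ncard_eq_zero ((finite_branchTuples _ _ t ht).subset (Set.sep_subset _ _))]
      refine Set.eq_empty_of_forall_notMem fun b hb => h fun i _ => ?_
      exact valid_of_mem_branchTuples (κ := κ) hb.1 hb.2 i
  change Run _ _ _ (enc active tie₀ (.next κ 0) 0 c l fun _ => 0) _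
  rw [hite]
  refine hround ?_
  · intro hv l' hs'
    replace hv : ∀ i, κ.Valid active i (M.enabled x (c i)) := fun i => hv i (Fin.zero_le _)
    have hc' : ∀ i t, |(advanceCfg x (u i) (c i)).workHead t| ≤ B := fun i => hM _ (hs' i).2.1
    have hncard := ncard_branchTuples_head?_eq (κ := κ) hv hu
    by_cases hnone : ∀ i, u i = none
    · have hadv : (fun i => advanceCfg x (u i) (c i)) = c := by
        funext i
        rw [hnone i]
        rfl
      have hrun := enc_next_last_run_of_guess_eq_none (active := active) (tie₀ := tie₀) (x := x)
        (κ := { κ with st := fun i => (advanceCfg x (u i) (c i)).state }) (l := l') hc' hnone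
      rw [hncard, ncard_branchTuples_of_halted]
      · exact hrun
      · intro i hi
        have := hv i
        simp only [Context.Valid, hκ, hnone i] at this
        simpa [hκ, hnone i, advanceCfg] using this hi
    -- Some copy moves, so the total remaining time drops below `T` and the induction hypothesis
    -- covers the next round.
    · push Not at hnone
      refine enc_next_last_run hc' hnone ?_
      rw [hncard]
      choose t' ht1 ht2 ht3 using fun i => exists_haltsWithin_advanceCfg (ht i) (hv i)
      obtain ⟨j, hj⟩ := hnone
      have hlt : ∑ i, t' i < T := lt_of_lt_of_le
        (Finset.sum_lt_sum (fun i _ => ht1 i) ⟨j, Finset.mem_univ _, ht3 j hj⟩) hT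
      exact ih _ hlt hs' t' ht2 le_rfl

theorem init_copies :
    (M.copies J ι active tie₀).init =
      enc active tie₀ .start 0 (fun _ => M.init) (fun _ => []) fun _ => 0 := by
  refine Cfg.eq_of rfl rfl ?_ ?_
  · rintro ⟨k, _ | t⟩ <;> rfl
  · rintro ⟨k, _ | t⟩
    · funext z
      cases z <;> rfl
    · rfl

theorem run_init [Fintype ι] (hB : x.length + 1 < 2 ^ B)
    (hM : ∀ c, M.Reachable x c → ∀ t, |c.workHead t| ≤ B)
    (hh : Acc (fun c' c => M.Step x c c') M.init) :
    (M.copies J ι active tie₀).Run x B (M.copies J ι active tie₀).init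
      (∑ k, (branchTuples M x (active k) (tie₀ k) fun _ => M.init).ncard) := by
  have hc : ∀ (k : Fin J) t, |((fun _ => M.init : Fin J → M.Cfg) k).workHead t| ≤ B := by
    simp [init]
  obtain ⟨t, ht⟩ := exists_haltsWithin hh
  rw [init_copies]
  refine Run.branch Finset.univ (fun k => idle (scanned (fun _ : Fin J => M.init) (fun _ => [])
    fun _ => 0) .stay (.main k (fun _ => M.start) (tie₀ k))) ?_ _
    (abs_workHead_enc_le hc (by simp)) id ?_ ?_
  · intro k k' h
    exact (Control.main.inj (congrArg NTMAction.next h)).1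
  · intro a
    rw [enabled_enc]
    simp only [Finset.mem_univ, true_and]
    exact Iff.rfl
  · intro k _
    rw [exec_idle]
    refine run_main hB hM k _ (fun i => ⟨rfl, .refl, rfl, by simp⟩) (fun _ => t) (fun _ => ht) le_rfl

end Copies

/-- The number of increasing tuples of accepting branches. -/
theorem ncard_branchTuples_init {M : NTM α} [LinearOrder M.Action] {x : List α}
    (hh : Acc (fun c' c => M.Step x c c') M.init) {J : ℕ} (j : ℕ) (hj : j ≤ J) :
    (Copies.branchTuples M x (fun i : Fin J => (i : ℕ) < j)
      (fun i i' => i < i' ∧ (i' : ℕ) < j) fun _ => M.init).ncard = (M.numAccepting x).choose j := by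
  obtain ⟨t, ht⟩ := exists_haltsWithin hh
  have hf := finite_isAcceptingBranch ht
  rw [numAccepting, Set.ncard_eq_toFinset_card _ hf, ← Finset.card_powersetCard,
    ← Set.ncard_coe_finset]
  symm
  have hcard : ∀ s ∈ (↑(Finset.powersetCard j hf.toFinset) : Set (Finset (List M.Action))),
      s.card = j := fun s hs => (Finset.mem_powersetCard.1 hs).2
  have hsub : ∀ s ∈ (↑(Finset.powersetCard j hf.toFinset) : Set (Finset (List M.Action))),
      ∀ b ∈ s, M.IsAcceptingBranch x M.init b := fun s hs b hb => by
    simpa using (Finset.mem_powersetCard.1 hs).1 hb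
  -- A set of `j` branches corresponds to its increasing enumeration; the inactive positions are
  -- filled with `[]`, as `branchTuples` prescribes.
  refine Set.ncard_congr (fun s hs i => if h : (i : ℕ) < j then
    s.orderEmbOfFin (hcard s hs) ⟨i, h⟩ else []) ?_ ?_ ?_
  · intro s hs
    refine ⟨fun i => ⟨fun h => ?_, fun h => dif_neg h⟩, fun i i' h => ?_⟩
    · simp only
      rw [dif_pos h]
      exact hsub s hs _ (Finset.orderEmbOfFin_mem _ _ _)
    · simp only
      rw [dif_pos h.2, dif_pos (lt_trans (Fin.lt_def.1 h.1) h.2)]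
      exact (s.orderEmbOfFin (hcard s hs)).strictMono h.1
  · intro s s' hs hs' h
    have : ∀ i : Fin j, s.orderEmbOfFin (hcard s hs) i = s'.orderEmbOfFin (hcard s' hs') i := by
      intro i
      have := congrFun h ⟨i, i.2.trans_le hj⟩
      simpa using this
    rw [← Finset.coe_inj, ← Finset.range_orderEmbOfFin s (hcard s hs),
      ← Finset.range_orderEmbOfFin s' (hcard s' hs'), funext this]
  · rintro b ⟨h1, h2⟩
    let f : Fin j → List M.Action := fun i => b ⟨i, i.2.trans_le hj⟩
    have hf' : StrictMono f := fun i i' h => h2 _ _ ⟨h, i'.2⟩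
    have hs : Finset.univ.image f ∈
        (↑(Finset.powersetCard j hf.toFinset) : Set (Finset (List M.Action))) := by
      refine Finset.mem_powersetCard.2 ⟨?_, ?_⟩
      · intro l hl
        obtain ⟨i, -, rfl⟩ := Finset.mem_image.1 hl
        simpa using (h1 ⟨i, i.2.trans_le hj⟩).1 i.2
      · rw [Finset.card_image_of_injective _ hf'.injective, Finset.card_univ, Fintype.card_fin]
    refine ⟨_, hs, ?_⟩
    funext i
    have h3 := Finset.orderEmbOfFin_unique (hcard _ hs) (f := f) (by simp) hf'
    split_ifs with h
    · rw [← h3]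
    · exact ((h1 i).2 h).symm

end NTM

/-- `#L` is closed under non-negative combinations of binomial coefficients. -/
theorem sum_mul_choose_mem_sharpL {α : Type} {φ : List α → ℕ} (hφ : φ ∈ SharpL α) (J : ℕ)
    (a : ℕ → ℕ) :
    (fun x => ∑ j ∈ Finset.range (J + 1), a j * (φ x).choose j) ∈ SharpL α := by
  classical
  obtain ⟨M, ⟨C, hC⟩, hh, hM⟩ := hφ
  obtain ⟨e⟩ : Nonempty (M.Action ≃ Fin (Nat.card M.Action)) := ⟨Finite.equivFin _⟩
  let : LinearOrder M.Action := LinearOrder.lift' e e.injective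
  -- The initial guess is a pair of an index `j` and one of `a j` labels, which produces the
  -- coefficient; then the first `j` copies are active and required to be increasing. The constant
  -- `C + 2` leaves room for the work heads of `M` and for counters with values up to `x.length +
  -- 1`.
  refine NTM.mem_sharpL_of_run (M.copies J (Σ j : Fin (J + 1), Fin (a j))
    (fun k i => (i : ℕ) < k.1) (fun k i i' => i < i' ∧ (i' : ℕ) < k.1)) (C + 2) fun x => ?_
  have hB : x.length + 1 < 2 ^ ((C + 2) * (Nat.log 2 x.length + 1)) := by
    have h1 : x.length < 2 ^ (Nat.log 2 x.length + 1) := Nat.lt_pow_succ_log_self (by norm_num) _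
    calc x.length + 1 < 2 ^ (Nat.log 2 x.length + 1) * 2 := by
          have : 1 < 2 ^ (Nat.log 2 x.length + 1) := Nat.one_lt_two_pow (by omega)
          omega
      _ = 2 ^ (Nat.log 2 x.length + 1 + 1) := (pow_succ _ _).symm
      _ ≤ _ := Nat.pow_le_pow_right (by norm_num) (by nlinarith)
  have hCx : ∀ c, M.Reachable x c → ∀ t,
      |c.workHead t| ≤ ((C + 2) * (Nat.log 2 x.length + 1) : ℕ) := fun c hc t =>
    (hC x c hc t).trans (by exact_mod_cast Nat.mul_le_mul_right _ (by omega))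
  convert NTM.Copies.run_init hB hCx (hh x) using 1
  rw [Fintype.sum_sigma, Finset.sum_range]
  refine Finset.sum_congr rfl fun j _ => ?_
  simp only [NTM.ncard_branchTuples_init (hh x) j (Nat.lt_succ_iff.1 j.2), hM]
  simp

/-! ### Combinations of binomial coefficients with natural coefficients -/

/-- Non-negative integer combinations of the functions `n ↦ n.choose j`. -/
def chooseSpan : Submodule ℕ (ℕ → ℕ) :=
  Submodule.span ℕ (Set.range fun j n => Nat.choose n j)

theorem choose_mem_chooseSpan (j : ℕ) : (fun n => Nat.choose n j) ∈ chooseSpan :=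
  Submodule.subset_span ⟨j, rfl⟩

theorem const_mem_chooseSpan (c : ℕ) : (fun _ => c) ∈ chooseSpan := by
  convert chooseSpan.smul_mem c (choose_mem_chooseSpan 0) using 1
  funext n
  simp

/-- On generators, `n * n.choose j = j * n.choose j + (j + 1) * n.choose (j + 1)`: no subtraction is
needed, so the coefficients stay in `ℕ`. -/
theorem id_mul_mem_chooseSpan {F : ℕ → ℕ} (hF : F ∈ chooseSpan) :
    (fun n => n * F n) ∈ chooseSpan := by
  induction hF using Submodule.span_induction with
  | mem F h =>
    obtain ⟨j, rfl⟩ := h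
    convert chooseSpan.add_mem (chooseSpan.smul_mem j (choose_mem_chooseSpan j))
      (chooseSpan.smul_mem (j + 1) (choose_mem_chooseSpan (j + 1))) using 1
    funext n
    simp only [Pi.add_apply, Pi.smul_apply, smul_eq_mul]
    rw [mul_comm (j + 1), Nat.choose_succ_right_eq]
    rcases le_or_gt j n with h | h
    · obtain ⟨d, rfl⟩ := Nat.exists_eq_add_of_le h
      rw [Nat.add_sub_cancel_left]
      ring
    · simp [Nat.choose_eq_zero_of_lt h]
  | zero =>
    simp only [Pi.zero_apply, mul_zero]
    exact chooseSpan.zero_mem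
  | add F G _ _ hF hG =>
    convert chooseSpan.add_mem hF hG using 1
    funext n
    simp [mul_add]
  | smul c F _ hF =>
    convert chooseSpan.smul_mem c hF using 1
    funext n
    simp [mul_left_comm]

theorem pow_mem_chooseSpan (t : ℕ) : (fun n => n ^ t) ∈ chooseSpan := by
  induction t with
  | zero => simpa using const_mem_chooseSpan 1
  | succ t ih =>
    convert id_mul_mem_chooseSpan ih using 1
    funext n
    ring

theorem choose_add_mem_chooseSpan (c m : ℕ) : (fun n => Nat.choose (n + c) m) ∈ chooseSpan := by
  induction c generalizing m with
  | zero => exact choose_mem_chooseSpan m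
  | succ c ih =>
    cases m with
    | zero => simpa using const_mem_chooseSpan 1
    | succ m =>
      convert chooseSpan.add_mem (ih m) (ih (m + 1)) using 1
      funext n
      exact Nat.choose_succ_succ _ _

theorem comp_mem_sharpL {α : Type} {φ : List α → ℕ} (hφ : φ ∈ SharpL α) {F : ℕ → ℕ}
    (hF : F ∈ chooseSpan) : (fun x => F (φ x)) ∈ SharpL α := by
  obtain ⟨a, rfl⟩ := Finsupp.mem_span_range_iff_exists_finsupp.1 hF
  convert sum_mul_choose_mem_sharpL hφ (a.support.sup id) a using 1
  funext x
  rw [Finsupp.sum, Finset.sum_apply]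
  refine Finset.sum_subset (fun j hj => ?_) (fun j _ hj => ?_)
  · exact Finset.mem_range_succ_iff.2 (Finset.le_sup (f := id) hj)
  · simp [Finsupp.notMem_support_iff.1 hj]

/-! ### Divisibility and coprimality tests by binomial coefficients and powers -/

/-- All base-`p` digits of `p ^ e - 1` are `p - 1`; Lucas's theorem splits off the last one. If `p ∣
n`, the last digit of the upper argument is also `p - 1`, its factor is 1, and what remains is the
claim for `n / p`. Otherwise that digit is smaller than `p - 1`, and its factor vanishes. -/
theorem prime_dvd_choose_pow_sub_one_iff {p : ℕ} (hp : p.Prime) (e n : ℕ) :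
    p ∣ (n + (p ^ e - 1)).choose (p ^ e - 1) ↔ ¬ p ^ e ∣ n := by
  have := Fact.mk hp
  induction e generalizing n with
  | zero => simpa using hp.one_lt.ne'
  | succ e ih =>
    have hp2 := hp.two_le
    obtain ⟨q, hq⟩ : ∃ q, p ^ e = q + 1 := ⟨p ^ e - 1, by have := pow_pos hp.pos e; omega⟩
    obtain ⟨r, rfl⟩ : ∃ r, p = r + 1 := ⟨p - 1, by omega⟩
    simp only [hq, Nat.add_sub_cancel] at ih
    have h1 : (r + 1) ^ (e + 1) - 1 = r + (r + 1) * q := by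
      rw [pow_succ, hq]
      exact Nat.sub_eq_of_eq_add (by ring)
    have hmod : (r + (r + 1) * q) % (r + 1) = r := by
      rw [Nat.add_mul_mod_self_left, Nat.mod_eq_of_lt (by omega)]
    have hdiv : (r + (r + 1) * q) / (r + 1) = q := by
      rw [Nat.add_mul_div_left _ _ (by omega), Nat.div_eq_of_lt (by omega), zero_add]
    rw [h1, (Choose.choose_modEq_choose_mod_mul_choose_div_nat (p := r + 1)).dvd_iff dvd_rfl,
      hmod, hdiv]
    by_cases hn : (r + 1) ∣ n
    · obtain ⟨m, rfl⟩ := hn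
      have h2 : (r + 1) * m + (r + (r + 1) * q) = r + (r + 1) * (m + q) := by ring
      have hmod' : (r + (r + 1) * (m + q)) % (r + 1) = r := by
        rw [Nat.add_mul_mod_self_left, Nat.mod_eq_of_lt (by omega)]
      have hdiv' : (r + (r + 1) * (m + q)) / (r + 1) = m + q := by
        rw [Nat.add_mul_div_left _ _ (by omega), Nat.div_eq_of_lt (by omega), zero_add]
      rw [h2, hmod', hdiv', Nat.choose_self, one_mul, pow_succ', hq,
        Nat.mul_dvd_mul_iff_left (by omega)]
      exact ih m
    · have h2 : (n + (r + (r + 1) * q)) % (r + 1) < r := by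
        have h3 := Nat.mod_lt (n + (r + (r + 1) * q)) (y := r + 1) (by omega)
        refine lt_of_le_of_ne (by omega) fun h4 => hn ?_
        have h5 := Nat.div_add_mod (n + (r + (r + 1) * q)) (r + 1)
        rw [h4] at h5
        have h6 : n + (r + 1) * q = (r + 1) * ((n + (r + (r + 1) * q)) / (r + 1)) := by omega
        exact (Nat.dvd_add_left (dvd_mul_right _ q)).1 (h6 ▸ dvd_mul_right _ _)
      simp only [Nat.choose_eq_zero_of_lt h2, zero_mul, dvd_zero, true_iff]
      exact fun h => hn ((dvd_pow_self _ (by omega)).trans h)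

theorem dvd_iff_forall_primeFactors {k n : ℕ} (hk : k ≠ 0) :
    k ∣ n ↔ ∀ p ∈ k.primeFactors, p ^ k.factorization p ∣ n := by
  refine ⟨fun h p _ => (Nat.ordProj_dvd k p).trans h, fun h => ?_⟩
  rw [Nat.dvd_iff_prime_pow_dvd_dvd]
  intro p j hp hj
  rcases eq_or_ne j 0 with rfl | hj0
  · simp
  · have hpk : p ∣ k := (dvd_pow_self p hj0).trans hj
    exact (pow_dvd_pow p ((hp.pow_dvd_iff_le_factorization hk).1 hj)).trans
      (h p (Nat.mem_primeFactors.2 ⟨hp, hpk, hk⟩))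

theorem coprime_iff_forall_primeFactors {k m : ℕ} (hk : k ≠ 0) :
    m.Coprime k ↔ ∀ p ∈ k.primeFactors, ¬ p ∣ m := by
  constructor
  · intro h p hp hpm
    have hp' := Nat.mem_primeFactors.1 hp
    exact hp'.1.one_lt.ne' (Nat.eq_one_of_dvd_coprimes h hpm hp'.2.1)
  · exact fun h => Nat.coprime_of_dvd fun p hp hpm hpk =>
      h p (Nat.mem_primeFactors.2 ⟨hp, hpk, hk⟩) hpm

/-- A function that is coprime to `k` exactly at the multiples of `k`. -/
def multipleIndicator (k n : ℕ) : ℕ :=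
  ∑ p ∈ k.primeFactors, k / p ^ k.factorization p *
    (n + (p ^ k.factorization p - 1)).choose (p ^ k.factorization p - 1)

theorem coprime_multipleIndicator_iff {k : ℕ} (hk : k ≠ 0) (n : ℕ) :
    (multipleIndicator k n).Coprime k ↔ k ∣ n := by
  rw [coprime_iff_forall_primeFactors hk, dvd_iff_forall_primeFactors hk]
  refine forall₂_congr fun p hp => ?_
  obtain ⟨hpp, hpk, -⟩ := Nat.mem_primeFactors.1 hp
  -- Modulo `p` only the term of `p` survives, as `p` divides `k / q ^ k.factorization q` for every
  -- other prime `q`; the weight of the surviving term is prime to `p`.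
  rw [multipleIndicator, ← Finset.add_sum_erase _ _ hp, Nat.dvd_add_left, hpp.dvd_mul,
    prime_dvd_choose_pow_sub_one_iff hpp, or_iff_right (Nat.not_dvd_ordCompl hpp hk), not_not]
  refine Finset.dvd_sum fun q hq => Dvd.dvd.mul_right ?_ _
  obtain ⟨hqp, hq⟩ := Finset.mem_erase.1 hq
  have hqq := (Nat.mem_primeFactors.1 hq).1
  rw [← Nat.ordProj_mul_ordCompl_eq_self k q, hpp.dvd_mul] at hpk
  exact hpk.resolve_left fun h =>
    hqp ((Nat.prime_dvd_prime_iff_eq hpp hqq).1 (hpp.dvd_of_dvd_pow h)).symm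

theorem multipleIndicator_mem_chooseSpan (k : ℕ) : multipleIndicator k ∈ chooseSpan := by
  convert chooseSpan.sum_mem (t := k.primeFactors) fun p _ =>
    chooseSpan.smul_mem (k / p ^ k.factorization p)
      (choose_add_mem_chooseSpan (p ^ k.factorization p - 1) (p ^ k.factorization p - 1)) using 1
  funext n
  simp [multipleIndicator]

/-- The summand `k - 1` plays the role of `-1`, so the condition says `n ^ k.totient ≡ 1`. One
direction is Euler's theorem; conversely, a positive power of `n` that is 1 modulo `k` makes `n`
coprime to `k`. -/
theorem pow_totient_add_modEq_zero_iff {k : ℕ} (hk : 2 ≤ k) (n : ℕ) :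
    n ^ k.totient + (k - 1) ≡ 0 [MOD k] ↔ n.Coprime k := by
  have h1 : (1 : ℕ) + (k - 1) ≡ 0 [MOD k] := by
    rw [Nat.add_sub_cancel' (by omega)]
    simp [Nat.ModEq]
  constructor
  · intro h
    have h2 : n ^ k.totient ≡ 1 [MOD k] := Nat.ModEq.add_right_cancel' (k - 1) (h.trans h1.symm)
    have h3 : (n ^ k.totient).Coprime k := by
      rw [Nat.Coprime, h2.gcd_eq, Nat.gcd_one_left]
    exact (Nat.coprime_pow_left_iff (Nat.totient_pos.2 (by omega)) _ _).1 h3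
  · exact fun h => ((Nat.ModEq.pow_totient h).add_right _).trans h1

theorem mainTheorem9 (α : Type) [Finite α] (k : ℕ) (hk : 2 ≤ k) (L : Language α) :
    L ∈ CoModL k α ↔
      ∃ φ ∈ SharpL α, ∀ x : List α, x ∈ L ↔ Nat.Coprime (φ x) k := by
  constructor
  · rintro ⟨φ, hφ, h⟩
    refine ⟨_, comp_mem_sharpL hφ (multipleIndicator_mem_chooseSpan k), fun x => ?_⟩
    rw [h, coprime_multipleIndicator_iff (by omega), Nat.modEq_zero_iff_dvd]
  · rintro ⟨φ, hφ, h⟩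
    refine ⟨_, comp_mem_sharpL hφ (chooseSpan.add_mem (pow_mem_chooseSpan k.totient)
      (const_mem_chooseSpan (k - 1))), fun x => ?_⟩
    rw [h]
    exact (pow_totient_add_modEq_zero_iff hk _).symm
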